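/- **Setting.** Let $X,Y$ be real Banach spaces and $1<p,q<\infty$ with $\frac1p+\frac1q=1$. Assume that $X$ is $p$-convex and $q$-smooth, i.e. there is $c>0$ with $\delta_X(\epsilon)\ge c\,\epsilon^p$ for $0<\epsilon\le 2$ and $\rho_X(\tau)\le c\,\tau^q$ for $\tau>0$, where $$\delta_X(\epsilon)=\inf\{1-\|\tfrac12(x+\tilde x)\| : \|x\|=\|\tilde x\|=1,\ \|x-\tilde x\|\ge\epsilon\},\qquad \rho_X(\tau)=\sup\{\tfrac12(\|x+\tau\tilde x\|+\|x-\tau\tilde x\|-2):\|x\|=\|\tilde x\|=1\}.$$ For a normed space $E$ and an exponent $s>1$ the duality mapping is $J_s(x)=\{x^*\in E^*:\langle x^*,x\rangle=\|x\|\|x^*\|,\ \|x^*\|=\|x\|^{s-1}\}$. It is single valued on $X$ and on $X^*$. The map $J_p:X\to X^*$ is the duality mapping of $X$; $J_q^*:X^*\to X$ is the duality mapping of $X^*$ with exponent $q$, with $X^{**}$ identified with $X$; $j_p:Y\to Y^*$ is any single-valued selection of the duality mapping of $Y$ with exponent $p$. The Bregman distance is $$\Delta_s(x,\tilde x)=\tfrac1s\|\tilde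 x\|^s-\tfrac1s\|x\|^s-\langle J_s(x),\tilde x-x\rangle,$$ and for a non-empty closed convex $Z\subset X$ the Bregman projection is $P_Z(x)=\arg\min_{z\in Z}\Delta_p(x,z)$. **Space constants.** If $p\ge 2$ (which is automatic unless $\dim X\le 1$), there exist constants $C_p,G_q>0$ such that $$\Delta_p(x,\tilde x)\ge \tfrac{C_p}{p}\|x-\tilde x\|^p\quad(x,\tilde x\in X),\qquad \Delta_q(\xi,\tilde \xi)\le \tfrac{G_q}{q}\|\xi-\tilde \xi\|^q\quad(\xi,\tilde \xi\in X^*).\qquad(1)$$ Fix any constants $C_p,G_q>0$ for which (1) holds. **Assumptions.** Let $F:\mathcal D(F)\subset X\to Y$ be continuous, let $Z\subset X$ be closed and convex, $y\in Y$, $z^\dagger\in Z$, let $\mathfrak L,\hat{\mathfrak L},\mathfrak C,\eta>0$, and put $$\tilde{\mathfrak C}=\tfrac12\Big(\tfrac{C_p}{p}\Big)^{-2/p}\mathfrak L\,\mathfrak C^2,\qquad \rho=\tfrac{C_p}{p}(2\tilde{\mathfrak C}\hat{\mathfrak L})^{-p}\Big(1+\sqrt{1-8\tilde{\mathfrak C}\eta}-4\eta\tilde{\mathfrak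 C}\Big)^p,\qquad \mathcal B=\{x\in X:\Delta_p(x,z^\dagger)\le\rho\}.$$ Assume that $\mathcal B\subset\mathcal D(F)$ and: (a) $F$ is Fréchet differentiable at the points of $\mathcal B$, with $\|DF(x)\|\le\hat{\mathfrak L}$ and $\|DF(x)-DF(\tilde x)\|\le\mathfrak L\|x-\tilde x\|$ for all $x,\tilde x\in\mathcal B$; (b) $F$ is weakly sequentially closed: if $x_n\in\mathcal D(F)$, $x_n\rightharpoonup x$ and $F(x_n)\to v$, then $x\in\mathcal D(F)$ and $F(x)=v$; (c) $\Delta_p(x,\tilde x)\le\mathfrak C^p\|F(x)-F(\tilde x)\|^p$ for all $x,\tilde x\in\mathcal B\cap Z$; (d) $\|F(z^\dagger)-y\|\le\eta<\frac1{8\tilde{\mathfrak C}}$ (for instance, $\operatorname{dist}(y,F(Z))\le\eta$ and $z^\dagger$ is a best approximation). Let $\hat\eta>3\eta$. **Algorithm.** Start with $x_0\in Z$ such that $\Delta_p(x_0,z^\dagger)<\rho$. Put $r_k=\|F(x_k)-y\|$, $T_k=DF(x_k)^*j_p(F(x_k)-y)$, $\hat t_k=G_q\|T_k\|^q$, and $$u_k=-\tilde{\mathfrak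 C}r_k^2+(1-2\tilde{\mathfrak C}\eta)r_k-\eta-\tilde{\mathfrak C}\eta^2,\qquad \mu_k=\hat t_k^{-\frac1{q-1}}u_k^{\frac1{q-1}}r_k^{\frac{p-1}{q-1}},$$ $$v_k=\hat t_k^{-\frac1{q-1}}u_k^{\frac1{q-1}}r_k^{p^2-p}(r_k-\eta)-\tfrac1q\hat t_k^{-\frac1{q-1}}u_k^{p}r_k^{p^2-p},\qquad w_k=\tfrac{\mathfrak L}2\Big(\tfrac{C_p}p\Big)^{-2/p}\hat t_k^{-\frac1{q-1}}u_k^{\frac1{q-1}}r_k^{p^2-p},$$ and iterate $$\tilde x_{k+1}=J_q^*\big(J_p(x_k)-\mu_kT_k\big),\qquad x_{k+1}=P_Z(\tilde x_{k+1}),$$ until the first index $K$ with $\|F(x_K)-y\|\le\hat\eta$. **Theorem.** The iteration stops after finitely many steps: $K=\min\{k\in\mathbb N:\|F(x_k)-y\|\le\hat\eta\}$ exists. Until then it is well defined: $x_k\in Z\cap\mathcal B$ for $k\le K$, and $u_k>0$, $T_k\ne0$ for $k\le K-1$. For all $k\le K-1$, $$\Delta_p(x_{k+1},z^\dagger)\le\Delta_p(x_k,z^\dagger)+w_k\,\Delta_p(x_k,z^\dagger)^{2/p}-v_k,\qquad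 w_k\,\Delta_p(x_k,z^\dagger)^{2/p}-v_k<0,$$ so that the Bregman distance to $z^\dagger$ strictly decreases. -/

import Mathlib

open Filter Topology

noncomputable section

namespace BregmanDescent

section Geometry

/-- Modulus of convexity `δ_X(ε)`; extended-real valued, so that an infimum over the empty set is `⊤`. -/
def convexityModulus (X : Type*) [NormedAddCommGroup X] [NormedSpace ℝ X] (ε : ℝ) : EReal :=
  ⨅ (x : X) (x' : X) (_ : ‖x‖ = 1) (_ : ‖x'‖ = 1) (_ : ε ≤ ‖x - x'‖),
    ((1 - ‖(1 / 2 : ℝ) • (x + x')‖ : ℝ) : EReal)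

/-- Modulus of smoothness `ρ_X(τ)`. -/
def smoothnessModulus (X : Type*) [NormedAddCommGroup X] [NormedSpace ℝ X] (τ : ℝ) : EReal :=
  ⨆ (x : X) (x' : X) (_ : ‖x‖ = 1) (_ : ‖x'‖ = 1),
    ((1 / 2 * (‖x + τ • x'‖ + ‖x - τ • x'‖ - 2) : ℝ) : EReal)

/-- `X` is `p`-convex (convex of power type `p`). -/
def IsPConvex (X : Type*) [NormedAddCommGroup X] [NormedSpace ℝ X] (p : ℝ) : Prop :=
  ∃ c : ℝ, 0 < c ∧ ∀ ε : ℝ, 0 < ε → ε ≤ 2 → ((c * ε ^ p : ℝ) : EReal) ≤ convexityModulus X ε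

/-- `X` is `q`-smooth (smooth of power type `q`). -/
def IsQSmooth (X : Type*) [NormedAddCommGroup X] [NormedSpace ℝ X] (q : ℝ) : Prop :=
  ∃ c : ℝ, 0 < c ∧ ∀ τ : ℝ, 0 < τ → smoothnessModulus X τ ≤ ((c * τ ^ q : ℝ) : EReal)

variable {X : Type*} [NormedAddCommGroup X] [NormedSpace ℝ X]

/-- The set-valued duality mapping with gauge function `t ↦ t ^ (p - 1)`. -/
def dualitySet (p : ℝ) (x : X) : Set (StrongDual ℝ X) :=
  {ξ | ξ x = ‖x‖ * ‖ξ‖ ∧ ‖ξ‖ = ‖x‖ ^ (p - 1)}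

/-- The duality mapping `J_p` as a function: the element of `dualitySet p x`
(unique in a smooth space). -/
def dualityMap (p : ℝ) (x : X) : StrongDual ℝ X :=
  Classical.epsilon fun ξ => ξ ∈ dualitySet p x

/-- The duality mapping `J_q^* : X^* → X` of the dual space of a reflexive space `X`, where `X^{**}`
is identified with `X` by the canonical embedding. -/
def dualityMapStar (q : ℝ) (ξ : StrongDual ℝ X) : X :=
  Classical.epsilon fun x => NormedSpace.inclusionInDoubleDual ℝ X x ∈ dualitySet q ξ

/-- The Bregman distance `Δ_p(x, x')` of the functional `‖·‖ ^ p / p`, linearized at `x`. -/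
def bregmanDist (p : ℝ) (x x' : X) : ℝ :=
  1 / p * ‖x'‖ ^ p - 1 / p * ‖x‖ ^ p - dualityMap p x (x' - x)

/-- The Bregman ball `{x | Δ_p(x, z) ≤ ρ}`. -/
def bregmanBall (p : ℝ) (z : X) (ρ : ℝ) : Set X :=
  {x | bregmanDist p x z ≤ ρ}

/-- The Bregman projection of `x` onto `Z`: the minimizer of `Δ_p(x, ·)` on `Z`. -/
def bregmanProj (p : ℝ) (Z : Set X) (x : X) : X :=
  Classical.epsilon fun z => z ∈ Z ∧ ∀ w ∈ Z, bregmanDist p x z ≤ bregmanDist p x w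

/-- `Cp` is an admissible constant in `Δ_p(x, x') ≥ (Cp / p) ‖x - x'‖ ^ p` on `X`. -/
def IsLowerConst (X : Type*) [NormedAddCommGroup X] [NormedSpace ℝ X] (p Cp : ℝ) : Prop :=
  0 < Cp ∧ ∀ x x' : X, Cp / p * ‖x - x'‖ ^ p ≤ bregmanDist p x x'

/-- `Gq` is an admissible constant in `Δ_q(ξ, ξ') ≤ (Gq / q) ‖ξ - ξ'‖ ^ q` on the dual of `X`. -/
def IsUpperConst (X : Type*) [NormedAddCommGroup X] [NormedSpace ℝ X] (q Gq : ℝ) : Prop :=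
  0 < Gq ∧ ∀ ξ ξ' : StrongDual ℝ X, bregmanDist q ξ ξ' ≤ Gq / q * ‖ξ - ξ'‖ ^ q

end Geometry

section Scalars

/-- The constant `C̃ = (1/2) (Cp/p)^(-2/p) L C²`. -/
def ctilde (p Cp L C : ℝ) : ℝ := 1 / 2 * (Cp / p) ^ (-2 / p) * L * C ^ 2

/-- The convergence radius `ρ`. -/
def convRadius (p Cp L Lhat C η : ℝ) : ℝ :=
  Cp / p * (2 * ctilde p Cp L C * Lhat) ^ (-p) *
    (1 + √(1 - 8 * ctilde p Cp L C * η) - 4 * η * ctilde p Cp L C) ^ p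

/-- `u = -C̃ r² + (1 - 2 C̃ η) r - η - C̃ η²`, where `Ct` stands for `C̃`. -/
def uCoeff (Ct η r : ℝ) : ℝ := -Ct * r ^ 2 + (1 - 2 * Ct * η) * r - η - Ct * η ^ 2

/-- `t̂ = Gq t^q`. -/
def that (q Gq t : ℝ) : ℝ := Gq * t ^ q

/-- `v`, as a function of the residual `r` and of `t = ‖T‖`. -/
def vCoeff (p q Gq Ct η r t : ℝ) : ℝ :=
  that q Gq t ^ (-1 / (q - 1)) * uCoeff Ct η r ^ (1 / (q - 1)) * r ^ (p ^ 2 - p) * (r - η)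
    - 1 / q * that q Gq t ^ (-1 / (q - 1)) * uCoeff Ct η r ^ p * r ^ (p ^ 2 - p)

/-- `w`, as a function of the residual `r` and of `t = ‖T‖`. -/
def wCoeff (p q Cp Gq L Ct η r t : ℝ) : ℝ :=
  L / 2 * (Cp / p) ^ (-2 / p) * that q Gq t ^ (-1 / (q - 1)) *
    uCoeff Ct η r ^ (1 / (q - 1)) * r ^ (p ^ 2 - p)

/-- The step size `μ`, as a function of the residual `r` and of `t = ‖T‖`. -/
def stepSize (p q Gq Ct η r t : ℝ) : ℝ :=
  that q Gq t ^ (-1 / (q - 1)) * uCoeff Ct η r ^ (1 / (q - 1)) * r ^ ((p - 1) / (q - 1))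

end Scalars

section Algorithm

variable {X Y : Type*} [NormedAddCommGroup X] [NormedSpace ℝ X]
  [NormedAddCommGroup Y] [NormedSpace ℝ Y]

/-- `F`, with domain `D`, is weakly sequentially closed. -/
def WeaklySeqClosed (D : Set X) (F : X → Y) : Prop :=
  ∀ (s : ℕ → X) (x : X) (y : Y), (∀ n, s n ∈ D) →
    (∀ ξ : StrongDual ℝ X, Tendsto (fun n => ξ (s n)) atTop (𝓝 (ξ x))) →
    Tendsto (fun n => F (s n)) atTop (𝓝 y) → x ∈ D ∧ F x = y

/-- The standing assumption on the operator `F` with domain `D` and derivative `DF`, on the closed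
convex set `Z`, and on the Bregman ball of radius `ρ` around `zd`. Only the values of `F` on `D`
are constrained. -/
structure ForwardAssumption (p : ℝ) (D : Set X) (F : X → Y) (DF : X → X →L[ℝ] Y) (Z : Set X)
    (zd : X) (ρ L Lhat C : ℝ) : Prop where
  continuousOn : ContinuousOn F D
  ball_subset : bregmanBall p zd ρ ⊆ D
  hasFDeriv : ∀ x ∈ bregmanBall p zd ρ, HasFDerivWithinAt F (DF x) D x
  norm_deriv_le : ∀ x ∈ bregmanBall p zd ρ, ‖DF x‖ ≤ Lhat
  deriv_lipschitz : ∀ x ∈ bregmanBall p zd ρ, ∀ x' ∈ bregmanBall p zd ρ,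
    ‖DF x - DF x'‖ ≤ L * ‖x - x'‖
  weaklySeqClosed : WeaklySeqClosed D F
  isClosed : IsClosed Z
  convex : Convex ℝ Z
  stability : ∀ x ∈ bregmanBall p zd ρ ∩ Z, ∀ x' ∈ bregmanBall p zd ρ ∩ Z,
    bregmanDist p x x' ≤ C ^ p * ‖F x - F x'‖ ^ p

/-- `T = DF(x)^* j(F(x) - y)`. -/
def gradT (F : X → Y) (DF : X → X →L[ℝ] Y) (j : Y → StrongDual ℝ Y) (y : Y) (x : X) :
    StrongDual ℝ X :=
  (j (F x - y)).comp (DF x)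

/-- One step of the projected steepest descent iteration:
`x ↦ P_Z (J_q^* (J_p x - μ T))`. -/
def descentStep (p q Gq Ct η : ℝ) (F : X → Y) (DF : X → X →L[ℝ] Y) (j : Y → StrongDual ℝ Y)
    (y : Y) (Z : Set X) (x : X) : X :=
  bregmanProj p Z (dualityMapStar q (dualityMap p x -
    stepSize p q Gq Ct η ‖F x - y‖ ‖gradT F DF j y x‖ • gradT F DF j y x))

end Algorithm

end BregmanDescent

end

open Filter Topology

namespace BregmanDescent

/-! ### Duality sets and the Young inequality -/

section Duality

variable {X : Type*} [NormedAddCommGroup X] [NormedSpace ℝ X] {p q : ℝ}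

/-! Write `r` for the residual at `x` and `u = r - η - C̃ (r + η)²`. A dual gradient step changes
`Δ(x, zd)` by at most `(Gq/q)(μ‖T‖)^q - μ T(x - zd)`, and the Bregman projection does not undo this.
A Taylor expansion along the segment to `zd` bounds `T(x - zd)` below by `r^(p-1) (r - η - E)`,
where `E` majorizes the second-order remainder by a multiple of `Δ(x, zd)^(2/p)`. Stability gives `E
≤ C̃ (r + η)²`, so the bracket is at least `u`. The step size minimizes the resulting bound
`(Gq/q)(μ‖T‖)^q - μ r^(p-1) u`, which leaves a decrease of at least `μ r^(p-1) u / p`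
(`ForwardAssumption.descentStep_spec`).

As a function of `r + η`, `u` is a concave quadratic. Its lower root is at most `4η`, and the radius
`ρ` keeps `r + η` below its upper root. Hence `r > ηhat > 3η` forces a uniform decrease
(`ForwardAssumption.exists_uniform_decrease`), which the nonnegativity of `Δ` allows only finitely
often.

The geometry rests on two facts. Smoothness makes `J_p` the Gâteaux derivative of `‖·‖^p/p`, hence
single valued. The lower Bregman bound makes minimizing sequences Cauchy; this yields the
projections and the surjectivity of `J_p`, and by conjugation shows that `J_q^*` inverts `J_p`. -/

theorem dualityMap_mem (hp : 1 < p) (x : X) : dualityMap p x ∈ dualitySet p x := by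
  have hex : ∃ ξ : StrongDual ℝ X, ξ ∈ dualitySet p x := by
    rcases eq_or_ne x 0 with rfl | hx
    · exact ⟨0, by simp, by simp [Real.zero_rpow (sub_pos.2 hp).ne']⟩
    · obtain ⟨g, hg, hgx⟩ := exists_dual_vector ℝ x (norm_ne_zero_iff.2 hx)
      have hn : ‖(‖x‖ ^ (p - 1)) • g‖ = ‖x‖ ^ (p - 1) := by
        rw [norm_smul, hg, mul_one, Real.norm_of_nonneg (by positivity)]
      refine ⟨(‖x‖ ^ (p - 1)) • g, ?_, hn⟩
      rw [hn]
      simp [hgx, mul_comm]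
  exact Classical.epsilon_spec hex

theorem dualitySet_apply_self {x : X} {ξ : StrongDual ℝ X} (hp : 1 < p)
    (h : ξ ∈ dualitySet p x) : ξ x = ‖x‖ ^ p := by
  rw [h.1, h.2]
  conv_lhs => rw [← Real.rpow_one ‖x‖, ← Real.rpow_mul (norm_nonneg x), one_mul]
  rw [← Real.rpow_add' (norm_nonneg x) (by linarith)]
  congr 1
  ring

theorem norm_rpow_of_mem_dualitySet {x : X} {ξ : StrongDual ℝ X} (hpq : p.HolderConjugate q)
    (h : ξ ∈ dualitySet p x) : ‖ξ‖ ^ q = ‖x‖ ^ p := by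
  rw [h.2, ← Real.rpow_mul (norm_nonneg x), hpq.sub_one_mul_conj]

/-- Fenchel–Young inequality for `‖·‖ ^ p / p`. -/
theorem apply_le_young (hpq : p.HolderConjugate q) (ξ : StrongDual ℝ X) (x : X) :
    ξ x ≤ 1 / p * ‖x‖ ^ p + 1 / q * ‖ξ‖ ^ q := by
  have h := Real.young_inequality_of_nonneg (norm_nonneg x) (norm_nonneg ξ) hpq
  have h' := (le_abs_self _).trans (ξ.le_opNorm x)
  calc ξ x ≤ ‖x‖ * ‖ξ‖ := by linarith [mul_comm ‖x‖ ‖ξ‖]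
    _ ≤ _ := h
    _ = _ := by ring

theorem young_eq_of_mem_dualitySet {x : X} {ξ : StrongDual ℝ X} (hpq : p.HolderConjugate q)
    (h : ξ ∈ dualitySet p x) : ξ x = 1 / p * ‖x‖ ^ p + 1 / q * ‖ξ‖ ^ q := by
  rw [norm_rpow_of_mem_dualitySet hpq h, dualitySet_apply_self hpq.lt h, ← add_mul, one_div,
    one_div, hpq.inv_add_inv_eq_one, one_mul]

/-- Elements of the duality set are subgradients of `‖·‖ ^ p / p`. -/
theorem subgradient_of_mem_dualitySet {x : X} {ξ : StrongDual ℝ X} (hpq : p.HolderConjugate q)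
    (h : ξ ∈ dualitySet p x) (x' : X) :
    1 / p * ‖x‖ ^ p + ξ (x' - x) ≤ 1 / p * ‖x'‖ ^ p := by
  have h1 := apply_le_young hpq ξ x'
  have h2 := young_eq_of_mem_dualitySet hpq h
  rw [map_sub]
  linarith

theorem bregmanDist_nonneg (hpq : p.HolderConjugate q) (x x' : X) : 0 ≤ bregmanDist p x x' := by
  have := subgradient_of_mem_dualitySet hpq (dualityMap_mem hpq.lt x) x'
  unfold bregmanDist
  linarith

theorem bregmanDist_self (x : X) : bregmanDist p x x = 0 := by
  simp [bregmanDist]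

/-- In this form `x` enters only through `J_p x`, so a step in the dual space can be estimated
there. -/
theorem bregmanDist_eq_conj (hpq : p.HolderConjugate q) (x z : X) :
    bregmanDist p x z = 1 / p * ‖z‖ ^ p + 1 / q * ‖dualityMap p x‖ ^ q - dualityMap p x z := by
  have := young_eq_of_mem_dualitySet hpq (dualityMap_mem hpq.lt x)
  rw [bregmanDist, map_sub]
  linarith

/-- The gauges `t^(p-1)` and `t^(q-1)` are mutually inverse because `(p-1)(q-1) = 1`. -/
theorem inclusion_mem_dualitySet_iff {x : X} {ξ : StrongDual ℝ X} (hpq : p.HolderConjugate q) :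
    NormedSpace.inclusionInDoubleDual ℝ X x ∈ dualitySet q ξ ↔ ξ ∈ dualitySet p x := by
  have hn : ‖NormedSpace.inclusionInDoubleDual ℝ X x‖ = ‖x‖ :=
    (NormedSpace.inclusionInDoubleDualLi ℝ (E := X)).norm_map x
  have hpq1 : (p - 1) * (q - 1) = 1 := by
    have := hpq.sub_one_mul_conj
    linarith
  simp only [dualitySet, Set.mem_ofPred_eq, hn, NormedSpace.dual_def]
  constructor
  · rintro ⟨h1, h2⟩
    refine ⟨by rw [h1, mul_comm], ?_⟩
    rw [h2, ← Real.rpow_mul (norm_nonneg _), mul_comm, hpq1, Real.rpow_one]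
  · rintro ⟨h1, h2⟩
    refine ⟨by rw [h1, mul_comm], ?_⟩
    rw [h2, ← Real.rpow_mul (norm_nonneg _), hpq1, Real.rpow_one]

end Duality

/-! ### Differentiability of the norm in a `q`-smooth space -/

section Smooth

variable {X : Type*} [NormedAddCommGroup X] [NormedSpace ℝ X] {p q : ℝ}

theorem hasDerivAt_zero_of_abs_le_rpow {φ : ℝ → ℝ} {a K : ℝ} (hq : 1 < q)
    (h : ∀ t, |φ t - φ 0 - t * a| ≤ K * |t| ^ q) : HasDerivAt φ a 0 := by
  rw [hasDerivAt_iff_isLittleO_nhds_zero]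
  have hO : (fun t => φ (0 + t) - φ 0 - t • a) =O[𝓝 0] fun t : ℝ => |t| ^ q := by
    refine Asymptotics.IsBigO.of_bound K (Eventually.of_forall fun t => ?_)
    rw [zero_add, smul_eq_mul, Real.norm_eq_abs, Real.norm_of_nonneg (by positivity)]
    exact h t
  refine hO.trans_isLittleO ?_
  have hlim : Tendsto (fun t : ℝ => |t| ^ (q - 1)) (𝓝 0) (𝓝 0) := by
    have hc : ContinuousAt (fun t : ℝ => |t| ^ (q - 1)) 0 :=
      continuous_abs.continuousAt.rpow_const (Or.inr (by linarith))
    simpa [ContinuousAt, Real.zero_rpow (sub_pos.2 hq).ne'] using hc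
  have h1 : (fun t : ℝ => |t| ^ (q - 1) * t) =o[𝓝 0] fun t : ℝ => t := by
    simpa using ((Asymptotics.isLittleO_one_iff ℝ).2 hlim).mul_isBigO
      (Asymptotics.isBigO_refl (fun t : ℝ => t) (𝓝 0))
  refine (Asymptotics.isBigO_of_le _ fun t => ?_).trans_isLittleO h1
  rw [norm_mul, Real.norm_of_nonneg (by positivity), Real.norm_of_nonneg (by positivity),
    Real.norm_eq_abs, ← Real.rpow_add_one' (abs_nonneg t) (by linarith), sub_add_cancel]

/-- Second-difference estimate for the norm of a `q`-smooth space. -/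
theorem IsQSmooth.exists_norm_add_sub_le (hs : IsQSmooth X q) {x : X} (hx : x ≠ 0) (h : X)
    (hq : 1 < q) :
    ∃ K : ℝ, ∀ t : ℝ, ‖x + t • h‖ + ‖x - t • h‖ - 2 * ‖x‖ ≤ K * |t| ^ q := by
  obtain ⟨c, hc, hsm⟩ := hs
  rcases eq_or_ne h 0 with rfl | hh
  · refine ⟨0, fun t => ?_⟩
    simp only [smul_zero, add_zero, sub_zero, zero_mul]
    linarith
  have hx' := norm_pos_iff.2 hx
  have hh' := norm_pos_iff.2 hh
  have key : ∀ t : ℝ, 0 < t → ‖x + t • h‖ + ‖x - t • h‖ - 2 * ‖x‖ ≤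
      2 * ‖x‖ * c * (‖h‖ / ‖x‖) ^ q * t ^ q := by
    intro t ht
    -- After normalizing `x` and `h`, the increment `t • h` has relative size `t‖h‖/‖x‖`.
    have h1 := hsm (t * (‖h‖ / ‖x‖)) (by positivity)
    have h2 : ((1 / 2 * (‖‖x‖⁻¹ • x + (t * (‖h‖ / ‖x‖)) • (‖h‖⁻¹ • h)‖ +
        ‖‖x‖⁻¹ • x - (t * (‖h‖ / ‖x‖)) • (‖h‖⁻¹ • h)‖ - 2) : ℝ) : EReal) ≤
        smoothnessModulus X (t * (‖h‖ / ‖x‖)) := by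
      unfold smoothnessModulus
      refine le_iSup_of_le (‖x‖⁻¹ • x) (le_iSup_of_le (‖h‖⁻¹ • h) (le_iSup_of_le ?_
        (le_iSup_of_le ?_ le_rfl)))
      · rw [norm_smul, norm_inv, norm_norm, inv_mul_cancel₀ hx'.ne']
      · rw [norm_smul, norm_inv, norm_norm, inv_mul_cancel₀ hh'.ne']
    have h3 := EReal.coe_le_coe_iff.1 (h2.trans h1)
    have e : (t * (‖h‖ / ‖x‖)) • (‖h‖⁻¹ • h) = ‖x‖⁻¹ • t • h := by
      rw [smul_smul, smul_smul]
      congr 1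
      field_simp
    rw [e, ← smul_add, ← smul_sub, norm_smul, norm_smul, norm_inv, norm_norm,
      Real.mul_rpow ht.le (by positivity)] at h3
    have h4 := mul_le_mul_of_nonneg_left h3 (by positivity : 0 ≤ 2 * ‖x‖)
    have e2 : 2 * ‖x‖ * (1 / 2 * (‖x‖⁻¹ * ‖x + t • h‖ + ‖x‖⁻¹ * ‖x - t • h‖ - 2)) =
        ‖x + t • h‖ + ‖x - t • h‖ - 2 * ‖x‖ := by
      field_simp
    rw [e2] at h4
    linarith
  refine ⟨2 * ‖x‖ * c * (‖h‖ / ‖x‖) ^ q, fun t => ?_⟩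
  rcases lt_trichotomy t 0 with ht | rfl | ht
  · have := key (-t) (by linarith)
    rw [abs_of_neg ht]
    simp only [neg_smul, sub_neg_eq_add, ← sub_eq_add_neg] at this
    linarith
  · simp only [zero_smul, add_zero, sub_zero, abs_zero, Real.zero_rpow (by linarith : q ≠ 0)]
    linarith
  · rw [abs_of_pos ht]
    exact key t ht

/-- In a `q`-smooth space, `‖·‖ ^ p / p` is Gâteaux differentiable, and its derivative at `x` is any
element of the duality set. -/
theorem IsQSmooth.hasDerivAt_norm_rpow (hs : IsQSmooth X q) (hpq : p.HolderConjugate q) {x : X}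
    {ξ : StrongDual ℝ X} (hξ : ξ ∈ dualitySet p x) (h : X) :
    HasDerivAt (fun t : ℝ => 1 / p * ‖x + t • h‖ ^ p) (ξ h) 0 := by
  have hp := hpq.lt
  have hp0 : p ≠ 0 := by linarith
  rcases eq_or_ne x 0 with rfl | hx
  · have hξ0 : ξ = 0 := by
      rw [← norm_eq_zero, hξ.2, norm_zero, Real.zero_rpow (sub_pos.2 hp).ne']
    subst hξ0
    refine hasDerivAt_zero_of_abs_le_rpow (q := p) (K := 1 / p * ‖h‖ ^ p) hp fun t => ?_
    have : 0 ≤ 1 / p * (|t| ^ p * ‖h‖ ^ p) := by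
      have : 0 < p := by linarith
      positivity
    simp only [zero_add, norm_smul, Real.norm_eq_abs, zero_smul, norm_zero,
      Real.zero_rpow hp0, mul_zero, sub_zero, zero_apply,
      Real.mul_rpow (abs_nonneg t) (norm_nonneg h), abs_of_nonneg this]
    exact le_of_eq (by ring)
  · obtain ⟨K, hK⟩ := hs.exists_norm_add_sub_le hx h hpq.symm.lt
    have hx' := norm_pos_iff.2 hx
    have hR : 0 < ‖x‖ ^ (p - 1) := by positivity
    -- The normalized `ξ` supports the norm at `x`. Used at `-t • h`, this turns the
    -- second-difference bound into an upper bound for the remainder at `t • h`.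
    have low : ∀ k : X, ‖x‖ + ξ k / ‖x‖ ^ (p - 1) ≤ ‖x + k‖ := by
      intro k
      have h1 := (le_abs_self _).trans (ξ.le_opNorm (x + k))
      rw [map_add, hξ.1, hξ.2] at h1
      have h2 : (‖x‖ + ξ k / ‖x‖ ^ (p - 1)) * ‖x‖ ^ (p - 1) ≤ ‖x + k‖ * ‖x‖ ^ (p - 1) := by
        rw [add_mul, div_mul_cancel₀ _ hR.ne']
        linarith
      exact le_of_mul_le_mul_right h2 hR
    have hN : HasDerivAt (fun t : ℝ => ‖x + t • h‖) (ξ h / ‖x‖ ^ (p - 1)) 0 := by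
      refine hasDerivAt_zero_of_abs_le_rpow (K := K) hpq.symm.lt fun t => ?_
      have h1 := low (t • h)
      have h2 := low (-(t • h))
      have h3 := hK t
      simp only [map_neg, map_smul, smul_eq_mul, ← sub_eq_add_neg, mul_div_assoc,
        neg_div] at h1 h2
      simp only [zero_smul, add_zero]
      rw [abs_of_nonneg (by linarith)]
      linarith
    have h1 := (hN.rpow_const (p := p) (Or.inl (by simpa using hx))).const_mul (1 / p)
    have e : 1 / p * (ξ h / ‖x‖ ^ (p - 1) * p * ‖x + (0 : ℝ) • h‖ ^ (p - 1)) = ξ h := by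
      rw [zero_smul, add_zero]
      field_simp
    rwa [e] at h1

theorem IsQSmooth.dualityMap_eq (hs : IsQSmooth X q) (hpq : p.HolderConjugate q) {x : X}
    {ξ : StrongDual ℝ X} (hξ : ξ ∈ dualitySet p x) : dualityMap p x = ξ :=
  ContinuousLinearMap.ext fun h =>
    (hs.hasDerivAt_norm_rpow hpq (dualityMap_mem hpq.lt x) h).unique
      (hs.hasDerivAt_norm_rpow hpq hξ h)

end Smooth

end BregmanDescent

namespace BregmanDescent

/-! ### Consequences of the lower Bregman bound: minimizers, inverse duality map, projections -/

section LowerConst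

variable {X : Type*} [NormedAddCommGroup X] [NormedSpace ℝ X] {p q Cp : ℝ}

theorem IsLowerConst.le_norm_rpow (hC : IsLowerConst X p Cp) (hs : IsQSmooth X q)
    (hpq : p.HolderConjugate q) {x : X} {ξ : StrongDual ℝ X} (hξ : ξ ∈ dualitySet p x) (x' : X) :
    1 / p * ‖x‖ ^ p + ξ (x' - x) + Cp / p * ‖x - x'‖ ^ p ≤ 1 / p * ‖x'‖ ^ p := by
  have h := hC.2 x x'
  rw [bregmanDist, hs.dualityMap_eq hpq hξ] at h
  linarith

/-- Linearizing at the midpoint towards both ends, the linear terms cancel. -/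
theorem IsLowerConst.midpoint_le (hC : IsLowerConst X p Cp) (a b : X) :
    1 / p * ‖(1 / 2 : ℝ) • (a + b)‖ ^ p + Cp / p * ((1 / 2) * ‖a - b‖) ^ p ≤
      1 / 2 * (1 / p * ‖a‖ ^ p + 1 / p * ‖b‖ ^ p) := by
  set m := (1 / 2 : ℝ) • (a + b) with hm
  have h1 := hC.2 m a
  have h2 := hC.2 m b
  have ea : a - m = (1 / 2 : ℝ) • (a - b) := by rw [hm]; module
  have eb : b - m = -((1 / 2 : ℝ) • (a - b)) := by rw [hm]; module
  rw [norm_sub_rev, bregmanDist, ea, norm_smul, Real.norm_of_nonneg (by norm_num)] at h1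
  rw [norm_sub_rev, bregmanDist, eb, norm_neg, map_neg, norm_smul,
    Real.norm_of_nonneg (by norm_num)] at h2
  linarith

/-- The uniformly convex functional `‖·‖ ^ p / p - ξ` attains its minimum on closed convex sets. -/
theorem IsLowerConst.exists_isMinOn [CompleteSpace X] (hC : IsLowerConst X p Cp)
    (hpq : p.HolderConjugate q) {Z : Set X} (hZ : IsClosed Z) (hZc : Convex ℝ Z)
    (hne : Z.Nonempty) (ξ : StrongDual ℝ X) :
    ∃ z ∈ Z, ∀ w ∈ Z, 1 / p * ‖z‖ ^ p - ξ z ≤ 1 / p * ‖w‖ ^ p - ξ w := by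
  have hp0 : 0 < p := hpq.pos
  set g : X → ℝ := fun z => 1 / p * ‖z‖ ^ p - ξ z with hg
  have hgc : Continuous g := by
    have h1 : Continuous fun z : X => ‖z‖ ^ p := continuous_norm.rpow_const fun _ => Or.inr hp0.le
    exact (continuous_const.mul h1).sub ξ.continuous
  have hbdd : BddBelow (g '' Z) := by
    refine ⟨-(1 / q * ‖ξ‖ ^ q), ?_⟩
    rintro _ ⟨z, -, rfl⟩
    have := apply_le_young hpq ξ z
    simp only [hg]
    linarith
  set m := sInf (g '' Z) with hm
  have hml : ∀ z ∈ Z, m ≤ g z := fun z hz => csInf_le hbdd ⟨z, hz, rfl⟩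
  have hseq : ∀ n : ℕ, ∃ z ∈ Z, g z < m + 1 / ((n : ℝ) + 1) := by
    intro n
    obtain ⟨_, ⟨z, hz, rfl⟩, h⟩ := exists_lt_of_csInf_lt (hne.image g)
      (lt_add_of_pos_right m (by positivity : 0 < 1 / ((n : ℝ) + 1)))
    exact ⟨z, hz, h⟩
  choose s hsZ hs using hseq
  have hκ : 0 < Cp / p := div_pos hC.1 hp0
  have hlim0 : Tendsto (fun n : ℕ => 1 / ((n : ℝ) + 1)) atTop (𝓝 0) :=
    tendsto_one_div_add_atTop_nhds_zero_nat
  have hcau : CauchySeq s := by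
    refine cauchySeq_of_le_tendsto_0
      (fun n : ℕ => 2 * ((Cp / p)⁻¹ * (1 / ((n : ℝ) + 1))) ^ (1 / p)) ?_ ?_
    · intro k l N hk hl
      have h1 := hC.midpoint_le (s k) (s l)
      have h2 := hml _ (hZc (hsZ k) (hsZ l) (by norm_num : (0 : ℝ) ≤ 1 / 2)
        (by norm_num : (0 : ℝ) ≤ 1 / 2) (by norm_num))
      rw [← smul_add] at h2
      have h3 : ∀ i, N ≤ i → g (s i) < m + 1 / ((N : ℝ) + 1) := fun i hi =>
        (hs i).trans_le (by
          have : (N : ℝ) ≤ i := by exact_mod_cast hi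
          gcongr)
      have hk' := h3 k hk
      have hl' := h3 l hl
      simp only [hg, map_smul, map_add, smul_eq_mul] at h2 hk' hl'
      -- The midpoint lies in `Z`, so its value is at least `m`; the convexity gain is at most the
      -- excess of the two end values.
      have h4 : (1 / 2 * ‖s k - s l‖) ^ p ≤ (Cp / p)⁻¹ * (1 / ((N : ℝ) + 1)) := by
        rw [← div_eq_inv_mul, le_div_iff₀ hκ]
        linarith
      have h5 := Real.rpow_le_rpow (by positivity) h4 (by positivity : 0 ≤ 1 / p)
      rw [one_div p, Real.rpow_rpow_inv (by positivity) hp0.ne'] at h5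
      rw [dist_eq_norm, one_div p]
      linarith
    · have h1 : Tendsto (fun n : ℕ => (Cp / p)⁻¹ * (1 / ((n : ℝ) + 1))) atTop (𝓝 0) := by
        simpa using hlim0.const_mul (Cp / p)⁻¹
      have h2 := (h1.rpow_const (p := 1 / p) (Or.inr (by positivity))).const_mul 2
      rwa [Real.zero_rpow (by positivity), mul_zero] at h2
  obtain ⟨z, hz⟩ := cauchySeq_tendsto_of_complete hcau
  refine ⟨z, hZ.mem_of_tendsto hz (Eventually.of_forall hsZ), fun w hw => ?_⟩
  have h1 : Tendsto (fun n => g (s n)) atTop (𝓝 (g z)) := (hgc.tendsto z).comp hz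
  have h2 : Tendsto (fun n : ℕ => m + 1 / ((n : ℝ) + 1)) atTop (𝓝 m) := by
    simpa using hlim0.const_add m
  exact (le_of_tendsto_of_tendsto' h1 h2 fun n => (hs n).le).trans (hml w hw)

/-- Surjectivity of `J_p`: a minimizer of `‖·‖^p/p - ξ` over the whole space is stationary, and
stationarity says `J_p x = ξ`. -/
theorem IsLowerConst.exists_mem_dualitySet [CompleteSpace X] (hC : IsLowerConst X p Cp)
    (hs : IsQSmooth X q) (hpq : p.HolderConjugate q) (ξ : StrongDual ℝ X) :
    ∃ x : X, ξ ∈ dualitySet p x := by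
  obtain ⟨x, -, hx⟩ := hC.exists_isMinOn hpq isClosed_univ convex_univ Set.univ_nonempty ξ
  refine ⟨x, ?_⟩
  suffices h : dualityMap p x = ξ by
    rw [← h]
    exact dualityMap_mem hpq.lt x
  ext h
  have h1 := (hs.hasDerivAt_norm_rpow hpq (dualityMap_mem hpq.lt x) h).sub
    (((hasDerivAt_id (0 : ℝ)).mul_const (ξ h)).const_add (ξ x))
  have hmin : IsLocalMin (fun t : ℝ => 1 / p * ‖x + t • h‖ ^ p - (ξ x + t * ξ h)) 0 := by
    refine Eventually.of_forall fun t => ?_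
    have := hx (x + t • h) trivial
    simpa using this
  have := hmin.hasDerivAt_eq_zero h1
  linarith

theorem IsLowerConst.conj_le [CompleteSpace X] (hC : IsLowerConst X p Cp) (hs : IsQSmooth X q)
    (hpq : p.HolderConjugate q) {x : X} {ξ : StrongDual ℝ X} (hξ : ξ ∈ dualitySet p x)
    (ξ' : StrongDual ℝ X) :
    1 / q * ‖ξ'‖ ^ q ≤ 1 / q * ‖ξ‖ ^ q + (ξ' - ξ) x + Cp ^ (-q / p) / q * ‖ξ' - ξ‖ ^ q := by
  obtain ⟨x', hx'⟩ := hC.exists_mem_dualitySet hs hpq ξ'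
  have h1 := hC.le_norm_rpow hs hpq hξ x'
  have h2 := young_eq_of_mem_dualitySet hpq hξ
  have h3 := young_eq_of_mem_dualitySet hpq hx'
  have h4 := (le_abs_self _).trans ((ξ' - ξ).le_opNorm (x' - x))
  have hC0 := hC.1
  -- The weights `Cp^(±1/p)` make the first Young term equal to the convexity gain, which then
  -- absorbs the cross term.
  have h5 := Real.young_inequality_of_nonneg
    (by positivity : 0 ≤ Cp ^ (1 / p) * ‖x - x'‖) (by positivity : 0 ≤ Cp ^ (-1 / p) * ‖ξ' - ξ‖) hpq
  rw [Real.mul_rpow (by positivity) (by positivity), Real.mul_rpow (by positivity) (by positivity),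
    ← Real.rpow_mul hC0.le, ← Real.rpow_mul hC0.le, one_div_mul_cancel hpq.ne_zero,
    Real.rpow_one, div_mul_eq_mul_div, neg_one_mul] at h5
  have e : Cp ^ (1 / p) * ‖x - x'‖ * (Cp ^ (-1 / p) * ‖ξ' - ξ‖) = ‖ξ' - ξ‖ * ‖x' - x‖ := by
    have : Cp ^ (1 / p) * Cp ^ (-1 / p) = 1 := by
      rw [← Real.rpow_add hC0, ← add_div]
      simp
    rw [norm_sub_rev x x']
    linear_combination (‖x' - x‖ * ‖ξ' - ξ‖) * this
  rw [e] at h5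
  simp only [sub_apply, map_sub] at h1 h4 ⊢
  have e1 : Cp * ‖x - x'‖ ^ p / p = Cp / p * ‖x - x'‖ ^ p := by ring
  have e2 : Cp ^ (-q / p) * ‖ξ' - ξ‖ ^ q / q = Cp ^ (-q / p) / q * ‖ξ' - ξ‖ ^ q := by ring
  linarith

/-- Smoothness of the dual: the duality mapping of `X^*` inverts that of `X`. -/
theorem IsLowerConst.dualityMap_dual_eq [CompleteSpace X] (hC : IsLowerConst X p Cp)
    (hs : IsQSmooth X q) (hpq : p.HolderConjugate q) {x : X} {ξ : StrongDual ℝ X}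
    (hξ : ξ ∈ dualitySet p x) :
    dualityMap q ξ = NormedSpace.inclusionInDoubleDual ℝ X x := by
  have hmem := dualityMap_mem hpq.symm.lt ξ
  ext ζ
  set K := Cp ^ (-q / p) / q
  have low : ∀ t : ℝ, t * dualityMap q ξ ζ ≤ t * ζ x + K * ‖ζ‖ ^ q * |t| ^ q := by
    intro t
    have h1 := subgradient_of_mem_dualitySet hpq.symm hmem (ξ + t • ζ)
    have h2 := hC.conj_le hs hpq hξ (ξ + t • ζ)
    simp only [add_sub_cancel_left, map_smul, smul_eq_mul, smul_apply,
      norm_smul, Real.norm_eq_abs, Real.mul_rpow (abs_nonneg t) (norm_nonneg ζ)] at h1 h2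
    linarith
  -- Both signs of `t` in `low` bound the difference of the two functionals by `O(|t|^q)` after
  -- multiplication by `t`; hence it is a derivative of a constant.
  have h1 : HasDerivAt (fun _ : ℝ => (0 : ℝ)) (dualityMap q ξ ζ - ζ x) 0 := by
    refine hasDerivAt_zero_of_abs_le_rpow (K := K * ‖ζ‖ ^ q) hpq.symm.lt fun t => ?_
    have h2 := low t
    have h3 := low (-t)
    rw [abs_neg] at h3
    rw [abs_le]
    constructor <;> linarith
  have := h1.unique (hasDerivAt_const 0 0)
  rw [NormedSpace.dual_def]
  linarith

theorem IsLowerConst.isUpperConst [CompleteSpace X] (hC : IsLowerConst X p Cp)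
    (hs : IsQSmooth X q) (hpq : p.HolderConjugate q) : IsUpperConst X q (Cp ^ (-q / p)) := by
  refine ⟨Real.rpow_pos_of_pos hC.1 _, fun ξ ξ' => ?_⟩
  obtain ⟨x, hx⟩ := hC.exists_mem_dualitySet hs hpq ξ
  have h := hC.conj_le hs hpq hx ξ'
  rw [bregmanDist, hC.dualityMap_dual_eq hs hpq hx, NormedSpace.dual_def, norm_sub_rev]
  linarith

theorem IsLowerConst.dualityMap_dualityMapStar [CompleteSpace X] (hC : IsLowerConst X p Cp)
    (hs : IsQSmooth X q) (hpq : p.HolderConjugate q) (ξ : StrongDual ℝ X) :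
    dualityMap p (dualityMapStar q ξ) = ξ := by
  have hex : ∃ x, NormedSpace.inclusionInDoubleDual ℝ X x ∈ dualitySet q ξ := by
    obtain ⟨x, hx⟩ := hC.exists_mem_dualitySet hs hpq ξ
    exact ⟨x, (inclusion_mem_dualitySet_iff hpq).2 hx⟩
  exact hs.dualityMap_eq hpq ((inclusion_mem_dualitySet_iff hpq).1 (Classical.epsilon_spec hex))

theorem IsLowerConst.bregmanProj_spec [CompleteSpace X] (hC : IsLowerConst X p Cp)
    (hpq : p.HolderConjugate q) {Z : Set X} (hZ : IsClosed Z) (hZc : Convex ℝ Z)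
    (hne : Z.Nonempty) (x : X) :
    bregmanProj p Z x ∈ Z ∧
      ∀ w ∈ Z, bregmanDist p x (bregmanProj p Z x) ≤ bregmanDist p x w := by
  obtain ⟨z, hz, hmin⟩ := hC.exists_isMinOn hpq hZ hZc hne (dualityMap p x)
  have hex : ∃ z, z ∈ Z ∧ ∀ w ∈ Z, bregmanDist p x z ≤ bregmanDist p x w := by
    refine ⟨z, hz, fun w hw => ?_⟩
    have := hmin w hw
    simp only [bregmanDist, map_sub]
    linarith
  exact Classical.epsilon_spec hex

/-- The Bregman projection does not increase the Bregman distance to points of `Z`. -/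
theorem IsLowerConst.bregmanDist_bregmanProj_le [CompleteSpace X] (hC : IsLowerConst X p Cp)
    (hs : IsQSmooth X q) (hpq : p.HolderConjugate q) {Z : Set X} (hZ : IsClosed Z)
    (hZc : Convex ℝ Z) (x : X) {w : X} (hw : w ∈ Z) :
    bregmanDist p (bregmanProj p Z x) w ≤ bregmanDist p x w := by
  obtain ⟨hzZ, hmin⟩ := hC.bregmanProj_spec hpq hZ hZc ⟨w, hw⟩ x
  set z := bregmanProj p Z x
  -- First-order optimality of the projection, from difference quotients towards `w`. The claim then
  -- follows from `Δ(x,w) - Δ(z,w) = Δ(x,z) + (J z - J x)(w - z)`.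
  have hvar : dualityMap p x (w - z) ≤ dualityMap p z (w - z) := by
    have hder := (hs.hasDerivAt_norm_rpow hpq (dualityMap_mem hpq.lt z) (w - z)).hasDerivWithinAt
      (s := Set.Ioi 0)
    rw [hasDerivWithinAt_iff_tendsto_slope' (by simp)] at hder
    refine ge_of_tendsto hder ?_
    filter_upwards [Ioo_mem_nhdsGT (zero_lt_one' ℝ)] with t ht
    have h1 := hmin (z + t • (w - z)) (hZc.add_smul_sub_mem hzZ hw ⟨ht.1.le, ht.2.le⟩)
    simp only [bregmanDist, map_sub, map_add, map_smul, smul_eq_mul] at h1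
    rw [slope_def_field, le_div_iff₀ (by linarith [ht.1]), map_sub]
    simp only [zero_smul, add_zero, sub_zero]
    linarith
  have h0 := bregmanDist_nonneg hpq x z
  simp only [bregmanDist, map_sub] at h0 hvar ⊢
  linarith

/-- Bregman balls are star-shaped with respect to their center. -/
theorem bregmanDist_add_smul_le (hpq : p.HolderConjugate q) (x z : X) {t : ℝ} (ht0 : 0 ≤ t)
    (ht1 : t ≤ 1) : bregmanDist p (x + t • (z - x)) z ≤ bregmanDist p x z := by
  set m := x + t • (z - x) with hm
  have h1 := subgradient_of_mem_dualitySet hpq (dualityMap_mem hpq.lt x) m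
  have h2 := subgradient_of_mem_dualitySet hpq (dualityMap_mem hpq.lt m) x
  have e1 : m - x = t • (z - x) := by rw [hm]; module
  have e2 : x - m = -(t • (z - x)) := by rw [hm]; module
  have e3 : z - m = (1 - t) • (z - x) := by rw [hm]; module
  simp only [bregmanDist, e3]
  rw [e1] at h1
  rw [e2] at h2
  simp only [map_neg, map_smul, smul_eq_mul] at h1 h2 ⊢
  set a := dualityMap p x (z - x)
  set b := dualityMap p m (z - x)
  rcases eq_or_lt_of_le ht0 with h | h
  · have : m = x := by rw [hm, ← h]; simp
    have : b = a := by simp only [b, a, this]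
    rw [this, ← h]
    simp [‹m = x›]
  -- Monotonicity of `J_p` between `x` and `m`.
  · have hab : a ≤ b := le_of_mul_le_mul_left (by linarith) h
    nlinarith

end LowerConst

/-! ### From the modulus of convexity to a lower Bregman constant -/

section PConvex

variable {X : Type*} [NormedAddCommGroup X] [NormedSpace ℝ X] {p : ℝ}

/-- A scalar Clarkson inequality. -/
theorem half_add_rpow_add_half_sub_rpow_le (hp : 2 ≤ p) {s : ℝ} (hs0 : 0 ≤ s) (hs1 : s ≤ 1) :
    ((1 + s) / 2) ^ p + ((1 - s) / 2) ^ p ≤ (1 + s ^ p) / 2 := by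
  have sq : ∀ a : ℝ, 0 ≤ a → a ^ p = (a ^ 2) ^ (p / 2) := fun a ha => by
    rw [← Real.rpow_natCast, ← Real.rpow_mul ha]
    congr 1
    push_cast
    ring
  have hp2 : 1 ≤ p / 2 := by linarith
  -- Superadditivity of the power `p/2` reduces the claim to squares, whose sum is the mean of `1`
  -- and `s²`; convexity of the same power finishes.
  have h1 := Real.add_rpow_le_rpow_add (sq_nonneg ((1 + s) / 2)) (sq_nonneg ((1 - s) / 2)) hp2
  rw [← sq _ (by linarith), ← sq _ (by linarith)] at h1
  refine h1.trans ?_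
  have h2 := (convexOn_rpow hp2).2 (x := 1) (by simp) (y := s ^ 2)
    (by simp only [Set.mem_Ici]; positivity) (by norm_num : (0 : ℝ) ≤ 1 / 2)
    (by norm_num : (0 : ℝ) ≤ 1 / 2) (by norm_num)
  simp only [smul_eq_mul, Real.one_rpow, ← sq s hs0] at h2
  have e : ((1 + s) / 2) ^ 2 + ((1 - s) / 2) ^ 2 = 1 / 2 * 1 + 1 / 2 * s ^ 2 := by ring
  rw [e]
  linarith

/-- If `1 - ‖y‖` is at least half of `‖x - y‖`, the scalar Clarkson inequality gives the gain.
Otherwise `‖y‖ > 1/3`, and `y/‖y‖` is still at distance at least `‖x - y‖/2` from `x`, so the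
modulus applies to unit vectors. The minimum in the constant reflects these cases. -/
theorem IsPConvex.exists_unit_midpoint_le (hp : 2 ≤ p) (hX : IsPConvex X p) :
    ∃ κ : ℝ, 0 < κ ∧ ∀ x y : X, ‖x‖ = 1 → ‖y‖ ≤ 1 →
      ‖(1 / 2 : ℝ) • (x + y)‖ ^ p + κ * ‖x - y‖ ^ p ≤ (1 + ‖y‖ ^ p) / 2 := by
  obtain ⟨c, hc, hδ⟩ := hX
  have hp0 : 0 < p := by linarith
  refine ⟨min ((1 / 4) ^ p) ((2 / 3) ^ p * (c * (1 / 2) ^ p / 3)), by positivity, ?_⟩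
  intro x y hx hy
  set s := ‖y‖ with hs
  have hs0 : 0 ≤ s := norm_nonneg y
  set ε := ‖x - y‖ with hε
  have hε0 : 0 ≤ ε := norm_nonneg _
  have hclark := half_add_rpow_add_half_sub_rpow_le hp hs0 hy
  have hεs : ε ≤ 1 + s := by rw [← hx]; exact norm_sub_le x y
  have hεp : 0 ≤ ε ^ p := by positivity
  set m := ‖(1 / 2 : ℝ) • (x + y)‖ with hm
  have hm0 : 0 ≤ m := norm_nonneg _
  have hms : m ≤ (1 + s) / 2 := by
    rw [hm, norm_smul, Real.norm_of_nonneg (by norm_num)]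
    have := norm_add_le x y
    rw [hx] at this
    linarith
  rcases le_or_gt (ε / 2) (1 - s) with hcase | hcase
  · have h1 : m ^ p ≤ ((1 + s) / 2) ^ p := Real.rpow_le_rpow hm0 hms hp0.le
    have h2 : (1 / 4) ^ p * ε ^ p ≤ ((1 - s) / 2) ^ p := by
      rw [← Real.mul_rpow (by norm_num) hε0]
      exact Real.rpow_le_rpow (by positivity) (by linarith) hp0.le
    have h3 := mul_le_mul_of_nonneg_right
      (min_le_left ((1 / 4) ^ p) ((2 / 3) ^ p * (c * (1 / 2) ^ p / 3))) hεp
    linarith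
  · have hs3 : 1 / 3 < s := by linarith
    have hε1 : 0 < ε := by linarith
    have hsp : 0 < s := by linarith
    set A := (1 + s) / 2 with hA
    set d := c * (ε / 2) ^ p with hd
    have hd0 : 0 < d := by positivity
    have hunit : ‖s⁻¹ • y‖ = 1 := by
      rw [norm_smul, norm_inv, Real.norm_of_nonneg hs0, ← hs, inv_mul_cancel₀ hsp.ne']
    have hdist : ε / 2 ≤ ‖x - s⁻¹ • y‖ := by
      have h1 : ‖s⁻¹ • y - y‖ = 1 - s := by
        have : s⁻¹ • y - y = (s⁻¹ - 1) • y := by module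
        rw [this, norm_smul, ← hs, Real.norm_of_nonneg (sub_nonneg.2 ((one_le_inv₀ hsp).2 hy)),
          sub_mul, inv_mul_cancel₀ hsp.ne', one_mul]
      have h2 := norm_add_le (x - s⁻¹ • y) (s⁻¹ • y - y)
      rw [sub_add_sub_cancel, ← hε, h1] at h2
      linarith
    have hmod : d ≤ 1 - ‖(1 / 2 : ℝ) • (x + s⁻¹ • y)‖ := by
      have h1 := hδ (ε / 2) (by positivity) (by linarith)
      have h2 : convexityModulus X (ε / 2) ≤
          ((1 - ‖(1 / 2 : ℝ) • (x + s⁻¹ • y)‖ : ℝ) : EReal) := by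
        unfold convexityModulus
        exact iInf_le_of_le x (iInf_le_of_le (s⁻¹ • y) (iInf_le_of_le hx
          (iInf_le_of_le hunit (iInf_le_of_le hdist le_rfl))))
      exact EReal.coe_le_coe_iff.1 (h1.trans h2)
    have hd1 : d ≤ 1 := by linarith [norm_nonneg ((1 / 2 : ℝ) • (x + s⁻¹ • y))]
    have hm1 : m ≤ A * (1 - d / 3) := by
      have e : (1 / 2 : ℝ) • (x + y) =
          s • ((1 / 2 : ℝ) • (x + s⁻¹ • y)) + ((1 - s) / 2) • x := by
        have : s • s⁻¹ • y = y := by rw [smul_smul, mul_inv_cancel₀ hsp.ne', one_smul]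
        rw [smul_comm s, smul_add s, this]
        module
      have h1 := norm_add_le (s • ((1 / 2 : ℝ) • (x + s⁻¹ • y))) (((1 - s) / 2) • x)
      rw [← e, norm_smul, norm_smul s, Real.norm_of_nonneg hs0, norm_smul ((1 - s) / 2),
        Real.norm_of_nonneg (by linarith : 0 ≤ (1 - s) / 2), hx] at h1
      rw [hm, norm_smul]
      have h2 := mul_le_mul_of_nonneg_left hmod hs0
      have h3 : d * (1 / 3) ≤ d * s := mul_le_mul_of_nonneg_left hs3.le hd0.le
      have h4 : A * (d / 3) ≤ 1 * (d / 3) := mul_le_mul_of_nonneg_right (by linarith) (by linarith)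
      linarith
    have hA0 : 2 / 3 ≤ A := by linarith
    have h1 : m ^ p ≤ A ^ p * (1 - d / 3) := by
      calc m ^ p ≤ (A * (1 - d / 3)) ^ p := Real.rpow_le_rpow hm0 hm1 hp0.le
        _ = A ^ p * (1 - d / 3) ^ p := Real.mul_rpow (by linarith) (by linarith)
        _ ≤ A ^ p * (1 - d / 3) := by
          refine mul_le_mul_of_nonneg_left ?_ (Real.rpow_nonneg (by linarith) _)
          exact Real.rpow_le_self_of_le_one (by linarith) (by linarith) (by linarith)
    have h2 : (2 / 3 : ℝ) ^ p * (d / 3) ≤ A ^ p * (d / 3) :=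
      mul_le_mul_of_nonneg_right (Real.rpow_le_rpow (by norm_num) hA0 hp0.le) (by linarith)
    have h3 := mul_le_mul_of_nonneg_right
      (min_le_right ((1 / 4) ^ p) ((2 / 3) ^ p * (c * (1 / 2) ^ p / 3))) hεp
    have e : d = c * (1 / 2) ^ p * ε ^ p := by
      rw [hd, div_eq_mul_one_div ε, mul_comm ε, Real.mul_rpow (by norm_num) hε0, mul_assoc]
    have e' : (2 / 3 : ℝ) ^ p * (d / 3) = (2 / 3) ^ p * (c * (1 / 2) ^ p / 3) * ε ^ p := by
      rw [e]; ring
    have h4 : 0 ≤ ((1 - s) / 2) ^ p := Real.rpow_nonneg (by linarith) _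
    linarith

/-- In a `p`-convex space, `‖·‖ ^ p` is uniformly midpoint convex of power type `p`. -/
theorem IsPConvex.exists_midpoint_le (hp : 2 ≤ p) (hX : IsPConvex X p) :
    ∃ κ : ℝ, 0 < κ ∧ ∀ x y : X,
      ‖(1 / 2 : ℝ) • (x + y)‖ ^ p + κ * ‖x - y‖ ^ p ≤ (‖x‖ ^ p + ‖y‖ ^ p) / 2 := by
  obtain ⟨κ, hκ, h⟩ := hX.exists_unit_midpoint_le hp
  refine ⟨κ, hκ, ?_⟩
  have hp0 : p ≠ 0 := by linarith
  have key : ∀ x y : X, ‖y‖ ≤ ‖x‖ →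
      ‖(1 / 2 : ℝ) • (x + y)‖ ^ p + κ * ‖x - y‖ ^ p ≤ (‖x‖ ^ p + ‖y‖ ^ p) / 2 := by
    intro x y hxy
    rcases eq_or_ne x 0 with rfl | hx
    · have : y = 0 := by simpa using hxy
      subst this
      simp [Real.zero_rpow hp0]
    have hx' := norm_pos_iff.2 hx
    have hn : ∀ v : X, ‖‖x‖⁻¹ • v‖ = ‖x‖⁻¹ * ‖v‖ := fun v => by
      rw [norm_smul, norm_inv, norm_norm]
    have h1 := h (‖x‖⁻¹ • x) (‖x‖⁻¹ • y) (by rw [hn, inv_mul_cancel₀ hx'.ne'])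
      (by rw [hn, inv_mul_le_one₀ hx']; exact hxy)
    rw [← smul_add, ← smul_sub, smul_comm, hn, hn, hn,
      Real.mul_rpow (by positivity) (by positivity), Real.mul_rpow (by positivity) (by positivity),
      Real.mul_rpow (by positivity) (by positivity), Real.inv_rpow hx'.le] at h1
    have hR : 0 < ‖x‖ ^ p := by positivity
    have h2 := mul_le_mul_of_nonneg_left h1 hR.le
    have e1 : ‖x‖ ^ p * ((‖x‖ ^ p)⁻¹ * ‖(1 / 2 : ℝ) • (x + y)‖ ^ p +
        κ * ((‖x‖ ^ p)⁻¹ * ‖x - y‖ ^ p)) =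
        ‖(1 / 2 : ℝ) • (x + y)‖ ^ p + κ * ‖x - y‖ ^ p := by field_simp
    have e2 : ‖x‖ ^ p * ((1 + (‖x‖ ^ p)⁻¹ * ‖y‖ ^ p) / 2) = (‖x‖ ^ p + ‖y‖ ^ p) / 2 := by
      field_simp
    rwa [e1, e2] at h2
  intro x y
  rcases le_total ‖y‖ ‖x‖ with hxy | hxy
  · exact key x y hxy
  · rw [add_comm x y, norm_sub_rev, add_comm (‖x‖ ^ p)]
    exact key y x hxy

/-- The subgradient inequality at `x`, tested at the midpoint, sees half of the linear term;
doubling gives `2κ`. -/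
theorem IsPConvex.exists_isLowerConst {q : ℝ} (hpq : p.HolderConjugate q) (hp : 2 ≤ p)
    (hX : IsPConvex X p) : ∃ Cp, IsLowerConst X p Cp := by
  obtain ⟨κ, hκ, h⟩ := hX.exists_midpoint_le hp
  have hp0 : 0 < p := by linarith
  refine ⟨2 * κ, by positivity, fun x x' => ?_⟩
  have h1 := h x x'
  have h2 := subgradient_of_mem_dualitySet hpq (dualityMap_mem hpq.lt x)
    ((1 / 2 : ℝ) • (x + x'))
  have e : (1 / 2 : ℝ) • (x + x') - x = (1 / 2 : ℝ) • (x' - x) := by module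
  rw [e, map_smul, smul_eq_mul] at h2
  have h3 := mul_le_mul_of_nonneg_left h1 (by positivity : 0 ≤ 1 / p)
  have e2 : 2 * κ / p * ‖x - x'‖ ^ p = 2 * (1 / p * (κ * ‖x - x'‖ ^ p)) := by ring
  rw [bregmanDist, e2]
  rw [mul_add] at h3
  linarith

end PConvex

end BregmanDescent

namespace BregmanDescent

/-! ### The quadratic `u` and the step size -/

section Scalars

variable {p q Cp Gq L Lhat C Ct η r t : ℝ}

theorem ctilde_pos (hp : 0 < p) (hCp : 0 < Cp) (hL : 0 < L) (hC : 0 < C) :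
    0 < ctilde p Cp L C := by
  unfold ctilde
  positivity

/-- With `σ` the square root, `u` factors through its roots: the lower one, in `r + η`, is `(1 -
σ)/(2C̃) = 4η/(1 + σ)`. Replacing it by `4η` loses only a nonnegative term. -/
theorem mul_le_uCoeff (h8 : 8 * Ct * η < 1) (hη : 0 < η)
    (hr : 0 ≤ (1 + √(1 - 8 * Ct * η)) / 2 - Ct * (r + η)) :
    (r - 3 * η) * ((1 + √(1 - 8 * Ct * η)) / 2 - Ct * (r + η)) ≤ uCoeff Ct η r := by
  set σ := √(1 - 8 * Ct * η)
  have hσ0 : 0 ≤ σ := Real.sqrt_nonneg _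
  have hσ : σ ^ 2 = 1 - 8 * Ct * η := Real.sq_sqrt (by linarith)
  have e : uCoeff Ct η r = (r - 3 * η) * ((1 + σ) / 2 - Ct * (r + η)) +
      4 * η * σ / (1 + σ) * ((1 + σ) / 2 - Ct * (r + η)) := by
    unfold uCoeff
    field_simp
    linear_combination (-r - η) * hσ
  rw [e]
  have : 0 ≤ 4 * η * σ / (1 + σ) * ((1 + σ) / 2 - Ct * (r + η)) := by positivity
  linarith

/-- A Bregman distance below the convergence radius bounds the norm distance away from the
critical value. -/
theorem lt_of_lt_convRadius (hp : 0 < p) (hCp : 0 < Cp) (hL : 0 < L) (hLhat : 0 < Lhat)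
    (hC : 0 < C) (h8 : 8 * ctilde p Cp L C * η < 1) {δ : ℝ} (hδ0 : 0 ≤ δ)
    (hδ : δ < convRadius p Cp L Lhat C η) :
    2 * ctilde p Cp L C * Lhat * (δ / (Cp / p)) ^ (1 / p) <
      1 + √(1 - 8 * ctilde p Cp L C * η) - 4 * η * ctilde p Cp L C := by
  have hCt := ctilde_pos hp hCp hL hC
  unfold convRadius at hδ
  set Ct := ctilde p Cp L C
  have hσ0 : 0 ≤ √(1 - 8 * Ct * η) := Real.sqrt_nonneg _
  set A := 1 + √(1 - 8 * Ct * η) - 4 * η * Ct with hA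
  have hA0 : 0 < A := by linarith
  have hκ : 0 < Cp / p := by positivity
  have hb : 0 < 2 * Ct * Lhat := by positivity
  have h1 : δ / (Cp / p) < (A / (2 * Ct * Lhat)) ^ p := by
    rw [div_lt_iff₀ hκ, Real.div_rpow hA0.le hb.le, div_eq_mul_inv, ← Real.rpow_neg hb.le]
    linarith
  have h2 := Real.rpow_lt_rpow (by positivity) h1 (by positivity : 0 < 1 / p)
  rw [one_div, Real.rpow_rpow_inv (by positivity) hp.ne', lt_div_iff₀ hb] at h2
  rw [one_div]
  linarith

theorem stepSize_pos (hG : 0 < Gq) (ht : 0 < t) (hr : 0 < r) (hu : 0 < uCoeff Ct η r) :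
    0 < stepSize p q Gq Ct η r t := by
  unfold stepSize that
  positivity

theorem stepSize_mul_rpow (hpq : p.HolderConjugate q) (hr : 0 < r) :
    stepSize p q Gq Ct η r t * r ^ (p - 1) =
      that q Gq t ^ (-1 / (q - 1)) * uCoeff Ct η r ^ (1 / (q - 1)) * r ^ (p ^ 2 - p) := by
  have hq1 : 0 < q - 1 := sub_pos.2 hpq.symm.lt
  have e : (p - 1) / (q - 1) + (p - 1) = p ^ 2 - p := by
    have h1 : (p - 1) * (q - 1) = 1 := by
      have := hpq.sub_one_mul_conj
      linarith
    have h2 : (p - 1) / (q - 1) = (p - 1) * (p - 1) := by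
      rw [div_eq_iff hq1.ne', mul_assoc, h1, mul_one]
    rw [h2]
    ring
  rw [stepSize, mul_assoc, ← Real.rpow_add hr, e]

theorem vCoeff_eq (hpq : p.HolderConjugate q) (hr : 0 < r) (hu : 0 < uCoeff Ct η r) :
    vCoeff p q Gq Ct η r t =
      stepSize p q Gq Ct η r t * r ^ (p - 1) * (r - η - 1 / q * uCoeff Ct η r) := by
  have hq1 : 0 < q - 1 := sub_pos.2 hpq.symm.lt
  have e : uCoeff Ct η r ^ p = uCoeff Ct η r ^ (1 / (q - 1)) * uCoeff Ct η r := by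
    rw [← Real.rpow_add_one hu.ne']
    congr 1
    have := hpq.sub_one_mul_conj
    field_simp
    linarith
  rw [stepSize_mul_rpow hpq hr, vCoeff, e]
  ring

theorem wCoeff_eq (hpq : p.HolderConjugate q) (hr : 0 < r) :
    wCoeff p q Cp Gq L Ct η r t =
      L / 2 * (Cp / p) ^ (-2 / p) * (stepSize p q Gq Ct η r t * r ^ (p - 1)) := by
  rw [stepSize_mul_rpow hpq hr, wCoeff]
  ring

/-- This is optimality of the step size: `μ^(q-1) = t̂⁻¹ u r^(p-1)` is the stationarity condition
for `(Gq/q)(μt)^q - μ r^(p-1) u`. -/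
theorem stepSize_rpow_mul (hpq : p.HolderConjugate q) (hG : 0 < Gq) (ht : 0 < t) (hr : 0 < r)
    (hu : 0 < uCoeff Ct η r) :
    Gq / q * (stepSize p q Gq Ct η r t * t) ^ q =
      stepSize p q Gq Ct η r t * r ^ (p - 1) * (1 / q * uCoeff Ct η r) := by
  have hq1 : 0 < q - 1 := sub_pos.2 hpq.symm.lt
  have hμ := stepSize_pos (p := p) (q := q) hG ht hr hu
  have hth : 0 < that q Gq t := by unfold that; positivity
  have e : stepSize p q Gq Ct η r t ^ (q - 1) =
      (that q Gq t)⁻¹ * uCoeff Ct η r * r ^ (p - 1) := by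
    rw [stepSize, Real.mul_rpow (by positivity) (by positivity),
      Real.mul_rpow (by positivity) (by positivity), ← Real.rpow_mul hth.le,
      ← Real.rpow_mul hu.le, ← Real.rpow_mul hr.le, div_mul_cancel₀ _ hq1.ne',
      div_mul_cancel₀ _ hq1.ne', div_mul_cancel₀ _ hq1.ne', Real.rpow_one, Real.rpow_neg_one]
  have e2 : stepSize p q Gq Ct η r t ^ q =
      stepSize p q Gq Ct η r t ^ (q - 1) * stepSize p q Gq Ct η r t := by
    rw [← Real.rpow_add_one hμ.ne', sub_add_cancel]
  rw [Real.mul_rpow hμ.le ht.le, e2, e]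
  have hh : that q Gq t = Gq * t ^ q := rfl
  rw [hh]
  have := hpq.symm.pos
  have : 0 < t ^ q := by positivity
  field_simp

end Scalars

/-! ### Estimates for the operator and for one dual step -/

section Operator

variable {X Y : Type*} [NormedAddCommGroup X] [NormedSpace ℝ X]
  [NormedAddCommGroup Y] [NormedSpace ℝ Y] {p q Cp Gq ρ L Lhat C η : ℝ} {D : Set X} {F : X → Y}
  {DF : X → X →L[ℝ] Y} {Z : Set X} {zd : X} {y : Y} {j : Y → StrongDual ℝ Y}

theorem bregmanBall_add_smul_mem (hpq : p.HolderConjugate q) {x : X}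
    (hx : x ∈ bregmanBall p zd ρ) {t : ℝ} (ht : t ∈ Set.Icc (0 : ℝ) 1) :
    x + t • (zd - x) ∈ bregmanBall p zd ρ :=
  (bregmanDist_add_smul_le hpq x zd ht.1 ht.2).trans hx

theorem ForwardAssumption.hasDerivWithinAt_segment
    (h : ForwardAssumption p D F DF Z zd ρ L Lhat C) (hpq : p.HolderConjugate q) {x : X}
    (hx : x ∈ bregmanBall p zd ρ) {t : ℝ} (ht : t ∈ Set.Icc (0 : ℝ) 1) :
    HasDerivWithinAt (fun t : ℝ => F (x + t • (zd - x))) (DF (x + t • (zd - x)) (zd - x))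
      (Set.Icc 0 1) t := by
  have hγ : HasDerivAt (fun t : ℝ => x + t • (zd - x)) (zd - x) t := by
    simpa using ((hasDerivAt_id t).smul_const (zd - x)).const_add x
  exact (h.hasFDeriv _ (bregmanBall_add_smul_mem hpq hx ht)).comp_hasDerivWithinAt t
    hγ.hasDerivWithinAt fun s hs => h.ball_subset (bregmanBall_add_smul_mem hpq hx hs)

theorem ForwardAssumption.norm_sub_le (h : ForwardAssumption p D F DF Z zd ρ L Lhat C)
    (hpq : p.HolderConjugate q) {x : X} (hx : x ∈ bregmanBall p zd ρ) :
    ‖F zd - F x‖ ≤ Lhat * ‖zd - x‖ := by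
  have := norm_image_sub_le_of_norm_deriv_le_segment_01'
    (fun t ht => h.hasDerivWithinAt_segment hpq hx ht) (C := Lhat * ‖zd - x‖) (fun t ht =>
      (DF _).le_of_opNorm_le
        (h.norm_deriv_le _ (bregmanBall_add_smul_mem hpq hx ⟨ht.1, ht.2.le⟩)) _)
  simpa using this

/-- Second-order Taylor estimate along the segment from `x` to the center of the ball. -/
theorem ForwardAssumption.norm_taylor_le (h : ForwardAssumption p D F DF Z zd ρ L Lhat C)
    (hpq : p.HolderConjugate q) {x : X} (hx : x ∈ bregmanBall p zd ρ) :
    ‖F zd - F x - DF x (zd - x)‖ ≤ L / 2 * ‖zd - x‖ ^ 2 := by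
  set g : ℝ → Y := fun t => F (x + t • (zd - x)) - F x - t • DF x (zd - x) with hg
  have hder : ∀ t ∈ Set.Icc (0 : ℝ) 1, HasDerivWithinAt g
      (DF (x + t • (zd - x)) (zd - x) - DF x (zd - x)) (Set.Icc 0 1) t := by
    intro t ht
    have h2 : HasDerivWithinAt (fun t : ℝ => t • DF x (zd - x)) (DF x (zd - x))
        (Set.Icc 0 1) t := by
      simpa using (hasDerivWithinAt_id t (Set.Icc (0 : ℝ) 1)).smul_const (DF x (zd - x))
    exact ((h.hasDerivWithinAt_segment hpq hx ht).sub_const (F x)).sub h2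
  have key := image_norm_le_of_norm_deriv_right_le_deriv_boundary
    (f := g) (a := 0) (b := 1)
    (f' := fun t => DF (x + t • (zd - x)) (zd - x) - DF x (zd - x))
    (B := fun t => L / 2 * ‖zd - x‖ ^ 2 * t ^ 2) (B' := fun t => L * ‖zd - x‖ ^ 2 * t)
    (fun t ht => (hder t ht).continuousWithinAt)
    (fun t ht => (hder t ⟨ht.1, ht.2.le⟩).mono_of_mem_nhdsWithin
      (mem_of_superset (Icc_mem_nhdsGE ht.2) (Set.Icc_subset_Icc_left ht.1)))
    (by simp [hg])
    (fun t => by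
      have h1 := (hasDerivAt_pow 2 t).const_mul (L / 2 * ‖zd - x‖ ^ 2)
      have e : L / 2 * ‖zd - x‖ ^ 2 * (((2 : ℕ) : ℝ) * t ^ (2 - 1)) = L * ‖zd - x‖ ^ 2 * t := by
        push_cast
        ring
      rwa [e] at h1)
    (fun t ht => by
      have hm := bregmanBall_add_smul_mem hpq hx (t := t) ⟨ht.1, ht.2.le⟩
      have h1 := h.deriv_lipschitz _ hm _ hx
      rw [add_sub_cancel_left, norm_smul, Real.norm_of_nonneg ht.1] at h1
      have h2 := (DF (x + t • (zd - x)) - DF x).le_of_opNorm_le h1 (zd - x)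
      rw [sub_apply] at h2
      exact h2.trans (le_of_eq (by ring)))
  have := key (x := 1) ⟨zero_le_one, le_rfl⟩
  simpa [hg] using this

/-- `DF x (x - zd)` splits into the residual, the data error at `zd` and the Taylor remainder. The
duality functional gains `r^p` on the first and loses at most `r^(p-1)` times the norm on the
others. -/
theorem ForwardAssumption.le_gradT_apply (h : ForwardAssumption p D F DF Z zd ρ L Lhat C)
    (hpq : p.HolderConjugate q) (hj : ∀ v, j v ∈ dualitySet p v) (hη : ‖F zd - y‖ ≤ η) {x : X}
    (hx : x ∈ bregmanBall p zd ρ) :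
    ‖F x - y‖ ^ (p - 1) * (‖F x - y‖ - η - L / 2 * ‖x - zd‖ ^ 2) ≤
      gradT F DF j y x (x - zd) := by
  set ξ := j (F x - y) with hξ
  have hmem := hj (F x - y)
  have hself : ξ (F x - y) = ‖F x - y‖ ^ (p - 1) * ‖F x - y‖ := by
    rw [hmem.1, hmem.2, mul_comm]
  have hbound : ∀ v : Y, ∀ b : ℝ, ‖v‖ ≤ b → -(‖F x - y‖ ^ (p - 1) * b) ≤ ξ v := by
    intro v b hv
    have h1 := (neg_le_abs _).trans (ξ.le_opNorm v)
    rw [hξ, hmem.2] at h1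
    have h2 := mul_le_mul_of_nonneg_left hv (by positivity : 0 ≤ ‖F x - y‖ ^ (p - 1))
    linarith
  have h1 := hbound (y - F zd) η (by rwa [norm_sub_rev])
  have h2 := hbound _ _ (h.norm_taylor_le hpq hx)
  have e : gradT F DF j y x (x - zd) =
      ξ (F x - y) + ξ (y - F zd) + ξ (F zd - F x - DF x (zd - x)) := by
    rw [gradT, ContinuousLinearMap.comp_apply, ← map_add, ← map_add, ← hξ, ← neg_sub zd x, map_neg]
    congr 1
    abel
  rw [e, hself, norm_sub_rev x zd]
  linarith

theorem ForwardAssumption.norm_gradT_le (h : ForwardAssumption p D F DF Z zd ρ L Lhat C)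
    (hj : ∀ v, j v ∈ dualitySet p v) {x : X} (hx : x ∈ bregmanBall p zd ρ) :
    ‖gradT F DF j y x‖ ≤ ‖F x - y‖ ^ (p - 1) * Lhat := by
  refine (ContinuousLinearMap.opNorm_comp_le _ _).trans ?_
  rw [(hj (F x - y)).2]
  exact mul_le_mul_of_nonneg_left (h.norm_deriv_le x hx) (by positivity)

theorem IsLowerConst.norm_sub_le (hC : IsLowerConst X p Cp) (hp : 0 < p) (x z : X) :
    ‖x - z‖ ≤ (bregmanDist p x z / (Cp / p)) ^ (1 / p) := by
  have hκ : 0 < Cp / p := div_pos hC.1 hp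
  have h1 : ‖x - z‖ ^ p ≤ bregmanDist p x z / (Cp / p) := by
    rw [le_div_iff₀ hκ, mul_comm]
    exact hC.2 x z
  have h2 := Real.rpow_le_rpow (by positivity) h1 (by positivity : 0 ≤ 1 / p)
  rwa [one_div, Real.rpow_rpow_inv (by positivity) hp.ne', ← one_div] at h2

theorem IsLowerConst.norm_sub_sq_le (hC : IsLowerConst X p Cp) (hpq : p.HolderConjugate q)
    (x z : X) : ‖x - z‖ ^ 2 ≤ (Cp / p) ^ (-2 / p) * bregmanDist p x z ^ (2 / p) := by
  have hκ : 0 < Cp / p := div_pos hC.1 hpq.pos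
  have hΔ := bregmanDist_nonneg hpq x z
  have h1 := pow_le_pow_left₀ (norm_nonneg _) (hC.norm_sub_le hpq.pos x z) 2
  refine h1.trans (le_of_eq ?_)
  rw [← Real.rpow_natCast, ← Real.rpow_mul (by positivity), Real.div_rpow hΔ hκ.le, neg_div,
    Real.rpow_neg hκ.le, Nat.cast_ofNat, one_div_mul_eq_div, div_eq_inv_mul]

theorem ForwardAssumption.bregmanDist_rpow_le (h : ForwardAssumption p D F DF Z zd ρ L Lhat C)
    (hpq : p.HolderConjugate q) (hC : 0 < C) (hρ : 0 ≤ ρ) (hη : ‖F zd - y‖ ≤ η) (hzd : zd ∈ Z)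
    {x : X} (hx : x ∈ bregmanBall p zd ρ) (hxZ : x ∈ Z) :
    bregmanDist p x zd ^ (2 / p) ≤ C ^ 2 * (‖F x - y‖ + η) ^ 2 := by
  have hp0 := hpq.pos
  have h1 := h.stability x ⟨hx, hxZ⟩ zd ⟨by simpa [bregmanBall, bregmanDist_self] using hρ, hzd⟩
  have h2 : ‖F x - F zd‖ ≤ ‖F x - y‖ + η := by
    have := norm_sub_le_norm_sub_add_norm_sub (F x) y (F zd)
    rw [norm_sub_rev y] at this
    linarith
  rw [← Real.mul_rpow hC.le (norm_nonneg _)] at h1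
  have h3 := Real.rpow_le_rpow (bregmanDist_nonneg hpq x zd) h1 (by positivity : 0 ≤ 2 / p)
  rw [← Real.rpow_mul (by positivity), mul_div_cancel₀ _ hp0.ne', Real.rpow_two, mul_pow] at h3
  exact h3.trans (by gcongr)

/-- Effect of a dual gradient step on the Bregman distance. -/
theorem IsLowerConst.bregmanDist_dualStep_le [CompleteSpace X] (hC : IsLowerConst X p Cp)
    (hG : IsUpperConst X q Gq) (hs : IsQSmooth X q) (hpq : p.HolderConjugate q) (x z : X)
    {μ : ℝ} (hμ : 0 ≤ μ) (T : StrongDual ℝ X) :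
    bregmanDist p (dualityMapStar q (dualityMap p x - μ • T)) z ≤
      bregmanDist p x z + Gq / q * (μ * ‖T‖) ^ q - μ * T (x - z) := by
  have hmem := dualityMap_mem hpq.lt x
  have h1 := hG.2 (dualityMap p x) (dualityMap p x - μ • T)
  rw [bregmanDist, hC.dualityMap_dual_eq hs hpq hmem, NormedSpace.dual_def, sub_sub_cancel,
    norm_smul, Real.norm_of_nonneg hμ] at h1
  rw [bregmanDist_eq_conj hpq, bregmanDist_eq_conj hpq, hC.dualityMap_dualityMapStar hs hpq]
  simp only [sub_apply, smul_apply, smul_eq_mul, map_sub] at h1 ⊢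
  linarith

end Operator

end BregmanDescent

namespace BregmanDescent

/-! ### The descent step, its uniform gain, and termination -/

variable {X Y : Type*} [NormedAddCommGroup X] [NormedSpace ℝ X]
  [NormedAddCommGroup Y] [NormedSpace ℝ Y] {p q Cp Gq ρ L Lhat C η ηhat : ℝ} {D : Set X}
  {F : X → Y} {DF : X → X →L[ℝ] Y} {Z : Set X} {zd : X} {y : Y} {j : Y → StrongDual ℝ Y}

/-- One step of the iteration from a point of `Z` in the ball at which `u > 0`. -/
theorem ForwardAssumption.descentStep_spec [CompleteSpace X]
    (h : ForwardAssumption p D F DF Z zd ρ L Lhat C) (hpq : p.HolderConjugate q)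
    (hs : IsQSmooth X q) (hCp : IsLowerConst X p Cp) (hG : IsUpperConst X q Gq)
    (hj : ∀ v, j v ∈ dualitySet p v) (hL : 0 < L) (hC : 0 < C) (hρ : 0 ≤ ρ) (hzd : zd ∈ Z)
    (hη : ‖F zd - y‖ ≤ η) {x : X} (hx : x ∈ bregmanBall p zd ρ) (hxZ : x ∈ Z)
    (hr : 0 < ‖F x - y‖) (hu : 0 < uCoeff (ctilde p Cp L C) η ‖F x - y‖) :
    gradT F DF j y x ≠ 0 ∧
    descentStep p q Gq (ctilde p Cp L C) η F DF j y Z x ∈ Z ∧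
    bregmanDist p (descentStep p q Gq (ctilde p Cp L C) η F DF j y Z x) zd ≤
      bregmanDist p x zd +
        wCoeff p q Cp Gq L (ctilde p Cp L C) η ‖F x - y‖ ‖gradT F DF j y x‖ *
          bregmanDist p x zd ^ (2 / p) -
        vCoeff p q Gq (ctilde p Cp L C) η ‖F x - y‖ ‖gradT F DF j y x‖ ∧
    wCoeff p q Cp Gq L (ctilde p Cp L C) η ‖F x - y‖ ‖gradT F DF j y x‖ *
        bregmanDist p x zd ^ (2 / p) -
      vCoeff p q Gq (ctilde p Cp L C) η ‖F x - y‖ ‖gradT F DF j y x‖ ≤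
      -(1 / p * (that q Gq ‖gradT F DF j y x‖ ^ (-1 / (q - 1)) *
        uCoeff (ctilde p Cp L C) η ‖F x - y‖ ^ (1 / (q - 1)) * ‖F x - y‖ ^ (p ^ 2 - p) *
        uCoeff (ctilde p Cp L C) η ‖F x - y‖)) := by
  set Ct := ctilde p Cp L C with hCt
  set r := ‖F x - y‖ with hrdef
  set u := uCoeff Ct η r with hudef
  set T := gradT F DF j y x with hT
  have hκ : 0 < Cp / p := div_pos hCp.1 hpq.pos
  have hpair := h.le_gradT_apply hpq hj hη hx
  rw [← hrdef, ← hT] at hpair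
  set E := L / 2 * ((Cp / p) ^ (-2 / p) * bregmanDist p x zd ^ (2 / p)) with hE
  have hsq : L / 2 * ‖x - zd‖ ^ 2 ≤ E :=
    mul_le_mul_of_nonneg_left (hCp.norm_sub_sq_le hpq x zd) (by positivity)
  -- Here `r - η - u = C̃ (r + η)²`; `C̃` is the product of the Taylor, convexity and stability
  -- constants.
  have hEu : E ≤ r - η - u := by
    have h1 := h.bregmanDist_rpow_le hpq hC hρ hη hzd hx hxZ
    have h2 : E ≤ L / 2 * ((Cp / p) ^ (-2 / p) * (C ^ 2 * (r + η) ^ 2)) := by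
      rw [hE]
      gcongr
    refine h2.trans (le_of_eq ?_)
    rw [hudef, uCoeff, hCt, ctilde]
    ring
  have hrp : 0 < r ^ (p - 1) := by positivity
  have hTpair : r ^ (p - 1) * (r - η - E) ≤ T (x - zd) :=
    (mul_le_mul_of_nonneg_left (by linarith) hrp.le).trans hpair
  have hT0 : T ≠ 0 := by
    intro h0
    rw [h0, zero_apply] at hTpair
    have : 0 < r ^ (p - 1) * (r - η - E) := mul_pos hrp (by linarith)
    linarith
  have hTn : 0 < ‖T‖ := norm_pos_iff.2 hT0
  have hμ := stepSize_pos (p := p) (q := q) hG.1 hTn hr hu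
  have hv := vCoeff_eq (Gq := Gq) (t := ‖T‖) hpq hr hu
  have hw := wCoeff_eq (Cp := Cp) (Gq := Gq) (L := L) (Ct := Ct) (η := η) (t := ‖T‖) hpq hr
  have hpow := stepSize_rpow_mul hpq hG.1 hTn hr hu
  rw [← stepSize_mul_rpow hpq hr]
  set μ := stepSize p q Gq Ct η r ‖T‖ with hμdef
  have hwE : wCoeff p q Cp Gq L Ct η r ‖T‖ * bregmanDist p x zd ^ (2 / p) =
      μ * r ^ (p - 1) * E := by
    rw [hw, hE]
    ring
  refine ⟨hT0, (hCp.bregmanProj_spec hpq h.isClosed h.convex ⟨zd, hzd⟩ _).1, ?_, ?_⟩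
  · refine (hCp.bregmanDist_bregmanProj_le hs hpq h.isClosed h.convex _ hzd).trans
      ((hCp.bregmanDist_dualStep_le hG hs hpq x zd hμ.le T).trans ?_)
    have h1 := mul_le_mul_of_nonneg_left hTpair hμ.le
    rw [hpow, hwE, hv]
    linarith
  · rw [hwE, hv]
    have h1 := mul_le_mul_of_nonneg_left hEu (by positivity : 0 ≤ μ * r ^ (p - 1))
    have h2 : 1 / q = 1 - 1 / p := by
      rw [one_div, one_div, ← hpq.inv_add_inv_eq_one]
      ring
    rw [← hudef, h2]
    linarith

/-- As long as the residual exceeds `ηhat`, the steps are well defined and decrease the Bregman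
distance by a fixed amount. -/
theorem ForwardAssumption.exists_uniform_decrease [CompleteSpace X]
    (h : ForwardAssumption p D F DF Z zd (convRadius p Cp L Lhat C η) L Lhat C)
    (hpq : p.HolderConjugate q) (hs : IsQSmooth X q) (hCp : IsLowerConst X p Cp)
    (hG : IsUpperConst X q Gq) (hj : ∀ v, j v ∈ dualitySet p v) (hL : 0 < L) (hLhat : 0 < Lhat)
    (hC : 0 < C) (hzd : zd ∈ Z) (hη : ‖F zd - y‖ ≤ η) (hη0 : 0 < η)
    (h8 : 8 * ctilde p Cp L C * η < 1) (hηhat : 3 * η < ηhat) {δ : ℝ} (hδ0 : 0 ≤ δ)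
    (hδ : δ < convRadius p Cp L Lhat C η) :
    ∃ d : ℝ, 0 < d ∧ ∀ x ∈ Z, bregmanDist p x zd ≤ δ → ηhat < ‖F x - y‖ →
      0 < uCoeff (ctilde p Cp L C) η ‖F x - y‖ ∧
      gradT F DF j y x ≠ 0 ∧
      descentStep p q Gq (ctilde p Cp L C) η F DF j y Z x ∈ Z ∧
      bregmanDist p (descentStep p q Gq (ctilde p Cp L C) η F DF j y Z x) zd ≤
        bregmanDist p x zd +
          wCoeff p q Cp Gq L (ctilde p Cp L C) η ‖F x - y‖ ‖gradT F DF j y x‖ *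
            bregmanDist p x zd ^ (2 / p) -
          vCoeff p q Gq (ctilde p Cp L C) η ‖F x - y‖ ‖gradT F DF j y x‖ ∧
      wCoeff p q Cp Gq L (ctilde p Cp L C) η ‖F x - y‖ ‖gradT F DF j y x‖ *
          bregmanDist p x zd ^ (2 / p) -
        vCoeff p q Gq (ctilde p Cp L C) η ‖F x - y‖ ‖gradT F DF j y x‖ ≤ -d := by
  have hp0 := hpq.pos
  have hq1 : 0 < q - 1 := sub_pos.2 hpq.symm.lt
  have hG0 := hG.1
  have hκ : 0 < Cp / p := div_pos hCp.1 hp0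
  have hCt0 := ctilde_pos hp0 hCp.1 hL hC
  have hgap := lt_of_lt_convRadius hp0 hCp.1 hL hLhat hC h8 hδ0 hδ
  have hspec := fun x hx hxZ hr hu => h.descentStep_spec (x := x) hpq hs hCp hG hj hL hC
    (hδ0.trans hδ.le) hzd hη hx hxZ hr hu
  set Ct := ctilde p Cp L C
  set σ := √(1 - 8 * Ct * η) with hσ
  -- `N` bounds `‖x - zd‖` and `R` the residual; `γ > 0` says that `R + η` stays below the upper
  -- root of `u`, which is what the radius ensures.
  set N := (δ / (Cp / p)) ^ (1 / p) with hN
  have hN0 : 0 ≤ N := by positivity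
  set R := Lhat * N + η with hR
  have hR0 : 0 < R := by positivity
  set γ := (1 + σ) / 2 - Ct * (R + η) with hγ
  have hγ0 : 0 < γ := by
    rw [hγ, hR]
    linarith
  have hηhat0 : 0 < ηhat := by linarith
  set u₀ := (ηhat - 3 * η) * γ with hu₀
  have hu₀0 : 0 < u₀ := mul_pos (by linarith) hγ0
  set H := that q Gq (R ^ (p - 1) * Lhat) with hH
  have hH0 : 0 < H := by
    rw [hH, that]
    positivity
  refine ⟨1 / p * (H ^ (-1 / (q - 1)) * u₀ ^ (1 / (q - 1)) * ηhat ^ (p ^ 2 - p) * u₀),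
    by positivity, fun x hxZ hxδ hxr => ?_⟩
  have hxB : x ∈ bregmanBall p zd (convRadius p Cp L Lhat C η) := hxδ.trans hδ.le
  have hr0 : 0 < ‖F x - y‖ := hηhat0.trans hxr
  have hrR : ‖F x - y‖ ≤ R := by
    have h1 := h.norm_sub_le hpq hxB
    have h2 : ‖zd - x‖ ≤ N := by
      rw [norm_sub_rev]
      exact (hCp.norm_sub_le hp0 x zd).trans (Real.rpow_le_rpow
        (div_nonneg (bregmanDist_nonneg hpq x zd) hκ.le) (by gcongr) (by positivity))
    have h3 := norm_sub_le_norm_sub_add_norm_sub (F x) (F zd) y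
    rw [norm_sub_rev (F x) (F zd)] at h3
    have h4 := mul_le_mul_of_nonneg_left h2 hLhat.le
    linarith
  have hγr : γ ≤ (1 + σ) / 2 - Ct * (‖F x - y‖ + η) := by
    have := mul_le_mul_of_nonneg_left hrR hCt0.le
    linarith
  have hu : u₀ ≤ uCoeff Ct η ‖F x - y‖ :=
    (mul_le_mul (by linarith) hγr hγ0.le (by linarith)).trans
      (mul_le_uCoeff h8 hη0 (hγ0.le.trans hγr))
  have hu0 := hu₀0.trans_le hu
  obtain ⟨hT, hZ', hle, hneg⟩ := hspec x hxB hxZ hr0 hu0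
  refine ⟨hu0, hT, hZ', hle, hneg.trans (neg_le_neg ?_)⟩
  have hTn : 0 < ‖gradT F DF j y x‖ := norm_pos_iff.2 hT
  have hth0 : 0 < that q Gq ‖gradT F DF j y x‖ := by
    unfold that
    positivity
  have hthH : that q Gq ‖gradT F DF j y x‖ ≤ H := by
    have h1 := h.norm_gradT_le (y := y) hj hxB
    have h2 : ‖F x - y‖ ^ (p - 1) ≤ R ^ (p - 1) :=
      Real.rpow_le_rpow hr0.le hrR (sub_pos.2 hpq.lt).le
    have h3 := h1.trans (mul_le_mul_of_nonneg_right h2 hLhat.le)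
    rw [hH, that, that]
    exact mul_le_mul_of_nonneg_left (Real.rpow_le_rpow hTn.le h3 hpq.symm.pos.le) hG0.le
  -- The exponent is negative, so an upper bound on `‖T‖` bounds the gain from below.
  have hH' : H ^ (-1 / (q - 1)) ≤ that q Gq ‖gradT F DF j y x‖ ^ (-1 / (q - 1)) :=
    Real.rpow_le_rpow_of_nonpos hth0 hthH (div_nonpos_of_nonpos_of_nonneg (by norm_num) hq1.le)
  have hpp : 0 ≤ p ^ 2 - p := by nlinarith [hpq.lt]
  gcongr

end BregmanDescent

open BregmanDescent in
theorem mainTheorem1 {X Y : Type*}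
    [NormedAddCommGroup X] [NormedSpace ℝ X] [CompleteSpace X]
    [NormedAddCommGroup Y] [NormedSpace ℝ Y] [CompleteSpace Y]
    (p q : ℝ) (hpq : p.HolderConjugate q)
    (hconvex : IsPConvex X p) (hsmooth : IsQSmooth X q)
    (j : Y → StrongDual ℝ Y) (hj : ∀ v, j v ∈ dualitySet p v) :
    -- admissible space constants exist (`2 ≤ p` is automatic unless `dim X ≤ 1`)
    (2 ≤ p → (∃ Cp, IsLowerConst X p Cp) ∧ ∃ Gq, IsUpperConst X q Gq) ∧
    -- and the result holds for every choice of them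
    ∀ Cp Gq : ℝ, IsLowerConst X p Cp → IsUpperConst X q Gq →
    ∀ (D : Set X) (F : X → Y) (DF : X → X →L[ℝ] Y) (Z : Set X) (zd : X) (y : Y)
      (L Lhat C η ηhat : ℝ), 0 < L → 0 < Lhat → 0 < C →
    ForwardAssumption p D F DF Z zd (convRadius p Cp L Lhat C η) L Lhat C →
    zd ∈ Z → ‖F zd - y‖ ≤ η → 0 < η → η < (8 * ctilde p Cp L C)⁻¹ → 3 * η < ηhat →
    ∀ x : ℕ → X, x 0 ∈ Z → bregmanDist p (x 0) zd < convRadius p Cp L Lhat C η →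
    (∀ k, x (k + 1) = descentStep p q Gq (ctilde p Cp L C) η F DF j y Z (x k)) →
    ∃ K : ℕ, IsLeast {k | ‖F (x k) - y‖ ≤ ηhat} K ∧
      (∀ k ≤ K, x k ∈ Z ∩ bregmanBall p zd (convRadius p Cp L Lhat C η)) ∧
      ∀ k < K,
        0 < uCoeff (ctilde p Cp L C) η ‖F (x k) - y‖ ∧
        gradT F DF j y (x k) ≠ 0 ∧
        bregmanDist p (x (k + 1)) zd ≤ bregmanDist p (x k) zd +
          wCoeff p q Cp Gq L (ctilde p Cp L C) η ‖F (x k) - y‖ ‖gradT F DF j y (x k)‖ *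
            bregmanDist p (x k) zd ^ (2 / p) -
          vCoeff p q Gq (ctilde p Cp L C) η ‖F (x k) - y‖ ‖gradT F DF j y (x k)‖ ∧
        wCoeff p q Cp Gq L (ctilde p Cp L C) η ‖F (x k) - y‖ ‖gradT F DF j y (x k)‖ *
            bregmanDist p (x k) zd ^ (2 / p) -
          vCoeff p q Gq (ctilde p Cp L C) η ‖F (x k) - y‖ ‖gradT F DF j y (x k)‖ < 0 := by
  refine ⟨fun hp => ?_, ?_⟩
  · obtain ⟨Cp, hCp⟩ := hconvex.exists_isLowerConst hpq hp
    exact ⟨⟨Cp, hCp⟩, _, hCp.isUpperConst hsmooth hpq⟩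
  intro Cp Gq hCp hG D F DF Z zd y L Lhat C η ηhat hL hLhat hC h hzd hη hη0 hη8 hηhat x hx0 hδ hx
  have hCt0 := ctilde_pos hpq.pos hCp.1 hL hC
  have h8 : 8 * ctilde p Cp L C * η < 1 := by
    rwa [lt_inv_comm₀ hη0 (by positivity), ← one_div, lt_div_iff₀ hη0] at hη8
  obtain ⟨d, hd, hstep⟩ := h.exists_uniform_decrease hpq hsmooth hCp hG hj hL hLhat hC hzd hη hη0 h8
    hηhat (bregmanDist_nonneg hpq (x 0) zd) hδ
  -- The gain `d` is fixed by the initial distance; since distances only decrease, it serves every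
  -- step.
  have hinv : ∀ k, (∀ i < k, ηhat < ‖F (x i) - y‖) →
      x k ∈ Z ∧ bregmanDist p (x k) zd ≤ bregmanDist p (x 0) zd - k * d := by
    intro k
    induction k with
    | zero => exact fun _ => ⟨hx0, by simp⟩
    | succ k ih =>
      intro hk
      obtain ⟨hZ, hle⟩ := ih fun i hi => hk i (hi.trans k.lt_succ_self)
      have hkd : 0 ≤ (k : ℝ) * d := by positivity
      obtain ⟨-, -, hZ', hle', hneg⟩ := hstep (x k) hZ (by linarith) (hk k k.lt_succ_self)
      rw [hx k]
      refine ⟨hZ', ?_⟩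
      push_cast
      linarith
  have hex : ∃ k, ‖F (x k) - y‖ ≤ ηhat := by
    by_contra! hcon
    obtain ⟨n, hn⟩ := exists_nat_gt (bregmanDist p (x 0) zd / d)
    rw [div_lt_iff₀ hd] at hn
    have h1 := (hinv n fun i _ => hcon i).2
    have h2 := bregmanDist_nonneg hpq (x n) zd
    linarith
  classical
  have hlt : ∀ k < Nat.find hex, ηhat < ‖F (x k) - y‖ := fun k hk => not_le.1 (Nat.find_min hex hk)
  have hmem : ∀ k ≤ Nat.find hex,
      x k ∈ Z ∧ bregmanDist p (x k) zd ≤ bregmanDist p (x 0) zd := fun k hk => by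
    obtain ⟨hZ, hle⟩ := hinv k fun i hi => hlt i (hi.trans_le hk)
    have : 0 ≤ (k : ℝ) * d := by positivity
    exact ⟨hZ, by linarith⟩
  refine ⟨Nat.find hex, ⟨Nat.find_spec hex, fun k hk => Nat.find_min' hex hk⟩, fun k hk =>
    ⟨(hmem k hk).1, (hmem k hk).2.trans hδ.le⟩, fun k hk => ?_⟩
  obtain ⟨hu, hT, -, hle, hneg⟩ := hstep (x k) (hmem k hk.le).1 (hmem k hk.le).2 (hlt k hk)
  rw [hx k]
  exact ⟨hu, hT, hle, hneg.trans_lt (neg_lt_zero.2 hd)⟩
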